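/- Conventions. An Orlicz function is a finite-valued function $\varphi:\mathbb R\to[0,\infty)$ that is even, convex and non-decreasing on $[0,\infty)$, with $\varphi(0)=0$, $\varphi(t)>0$ for $t>0$ and $\lim_{t\to\infty}\varphi(t)=\infty$. A Young's function on $\mathbb R^n$ is an even convex function $\Psi:\mathbb R^n\to[0,\infty]$ with $\Psi(0)=0$ and $\lim_{t\to\infty}\Psi(tx)=\infty$ for every $x\neq0$. The associated Fenchel–Orlicz space is $$\ell_\Psi=\Big\{(v_k)_{k}\subset\mathbb R^n:\ \sum_k\Psi(v_k/\rho)<\infty\text{ for some }\rho>0\Big\},\qquad \|(v_k)_k\|_\Psi=\inf\Big\{\rho>0:\sum_k\Psi(v_k/\rho)\le1\Big\};$$ for $n=1$ and $\Psi=\varphi$ this is the Orlicz space $(\ell_\varphi,\|\cdot\|_\varphi)$. It has non-trivial type if for some $1<p\le2$ and some $C$ one has $2^{-m}\sum_{\varepsilon\in\{\pm1\}^m}\|\sum_i\varepsilon_ix_i\|_\varphi\le C(\sum_i\|x_i\|_\varphi^p)^{1/p}$ for all finite families $x_1,\dots,x_m$ in $\ell_\varphi$. The convex envelope of $\Phi:\mathbb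 R^2\to[0,\infty)$ is $\mathrm{co}\,\Phi(v)=\inf\{\sum_i\alpha_i\Phi(v_i)\}$ over all finite convex combinations $v=\sum_i\alpha_iv_i$; $\Phi$ is quasi-convex if for some $L>0$ one has $\Phi(av+bw)\le L(a\Phi(v)+b\Phi(w))$ for all $v,w$ and all $a,b\ge0$ with $a+b=1$. For an Orlicz function $\varphi$ and a Lipschitz map $\theta:\mathbb R\to\mathbb R$ put $F(y)_n=y_n\,\theta\big(\log(\|y\|_\varphi/|y_n|)\big)$ ($=0$ if $y_n=0$) and $$\|(x,y)\|=\|y\|_\varphi+\|x-F(y)\|_\varphi .$$ The twisted sum $\ell_\varphi\oplus_F\ell_\varphi$ is the space of all sequences $(x_n,y_n)_n$ in $\mathbb R^2$ with $\|(x,y)\|<\infty$, i.e. $y\in\ell_\varphi$ and $x-F(y)\in\ell_\varphi$. Let also $$\Phi_{\varphi,\theta}(x,y)=\varphi(y)+\varphi\big(x-y\,\theta(\log\tfrac1{|y|})\big)\ (y\ne0),\qquad \Phi_{\varphi,\theta}(x,0)=\varphi(x).$$ Theorem. Let $\varphi$ be an Orlicz function such that $\ell_\varphi$ has non-trivial type,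 and let $\theta:\mathbb R\to\mathbb R$ be Lipschitz. (1) $\|\cdot\|$ is a quasi-norm on the linear space $\ell_\varphi\oplus_F\ell_\varphi$, which is complete and contains $c_{00}\times c_{00}$ as a dense subspace; that is, $\ell_\varphi\oplus_F\ell_\varphi$ is the completion of $(c_{00}\times c_{00},\|\cdot\|)$. (2) $\ell_\varphi\oplus_F\ell_\varphi$ is a Fenchel–Orlicz space on $\mathbb R^2$: there is a Young's function $\Psi$ on $\mathbb R^2$ such that $\ell_\varphi\oplus_F\ell_\varphi=\ell_\Psi$ as sets and the identity map is an isomorphism, i.e. $\|\cdot\|$ and $\|\cdot\|_\Psi$ are equivalent. (3) There is an Orlicz function $\tilde\varphi$ that coincides with $\varphi$ on $[0,1]$ and satisfies (a) for some $p>1$, $M>0$: $\tilde\varphi(\lambda s)\le M\lambda^p\tilde\varphi(s)$ for all $0<\lambda\le1$, $s>0$; and (b) for some $C>0$: $\tilde\varphi(2s)\le C\tilde\varphi(s)$ for all $s\ge0$. For every such $\tilde\varphi$, $\Phi_{\tilde\varphi,\theta}$ is quasi-convex and (2) holds with $\Psi=\mathrm{co}\,\Phi_{\tilde\varphi,\theta}$.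 In particular, for $1<p<\infty$ the space $Z_p$, which is the twisted sum $\ell_\varphi\oplus_F\ell_\varphi$ for $\varphi(t)=|t|^p$ and $\theta(t)=t$, is a Fenchel–Orlicz space on $\mathbb R^2$: (1) holds for it, and (2) holds for it with $\Psi=\mathrm{co}\,\Phi_{\varphi,\theta}$. -/

import Mathlib

open Set Filter Topology
open scoped ENNReal NNReal

namespace TwistedSum

/-! ### Functions: Young, Orlicz, quasi-convex, convex envelope -/

/-- Young's functions on a real vector space: even, convex, with values in `[0, ∞]`, zero at the
origin, and tending to `∞` along every ray. -/
structure IsYoungFunction {E : Type*} [AddCommGroup E] [Module ℝ E] (Ψ : E → ℝ≥0∞) : Prop where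
  even : ∀ x, Ψ (-x) = Ψ x
  convex : ∀ x y : E, ∀ a b : ℝ≥0, a + b = 1 →
    Ψ ((a : ℝ) • x + (b : ℝ) • y) ≤ a * Ψ x + b * Ψ y
  map_zero : Ψ 0 = 0
  tendsto_top : ∀ x : E, x ≠ 0 → Tendsto (fun t : ℝ => Ψ (t • x)) atTop (𝓝 ⊤)

/-- (Finite, non-degenerate) Orlicz functions, extended to the real line as even functions. -/
structure IsOrliczFunction (φ : ℝ → ℝ) : Prop where
  convexOn : ConvexOn ℝ (Ici 0) φ
  monotoneOn : MonotoneOn φ (Ici 0)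
  map_zero : φ 0 = 0
  tendsto_atTop : Tendsto φ atTop atTop
  pos : ∀ x, 0 < x → 0 < φ x
  even : ∀ x, φ (-x) = φ x

/-- The (global) `Δ₂` condition. -/
def DeltaTwo (φ : ℝ → ℝ) : Prop :=
  ∃ C > 0, ∀ x, 0 ≤ x → φ (2 * x) ≤ C * φ x

/-- There are `p > 1` and `M > 0` with `φ (l s) ≤ M l ^ p φ s` for `0 < l ≤ 1` and `s > 0`. -/
def PowerBound (φ : ℝ → ℝ) : Prop :=
  ∃ p > (1 : ℝ), ∃ M > (0 : ℝ), ∀ l s : ℝ, 0 < l → l ≤ 1 → 0 < s →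
    φ (l * s) ≤ M * l ^ p * φ s

/-- Quasi-convexity: convexity up to a multiplicative constant. -/
def IsQuasiConvex {E : Type*} [AddCommGroup E] [Module ℝ E] (Φ : E → ℝ) : Prop :=
  ∃ L > 0, ∀ x y : E, ∀ a b : ℝ, 0 ≤ a → 0 ≤ b → a + b = 1 →
    Φ (a • x + b • y) ≤ L * (a * Φ x + b * Φ y)

/-- The convex envelope of a non-negative function: the infimum of `∑ αᵢ Φ(tᵢ)` over all
representations of `x` as a finite convex combination `∑ αᵢ tᵢ`. -/
noncomputable def convexEnvelope {E : Type*} [AddCommGroup E] [Module ℝ E] (Φ : E → ℝ) (x : E) :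
    ℝ :=
  sInf {s | ∃ (m : ℕ) (α : Fin m → ℝ) (t : Fin m → E), (∀ i, 0 ≤ α i) ∧ ∑ i, α i = 1 ∧
    ∑ i, α i • t i = x ∧ ∑ i, α i * Φ (t i) = s}

/-! ### Fenchel–Orlicz sequence spaces -/

/-- The sequence space `ℓ_Ψ`: all sequences `x` with `∑ Ψ(xₖ / ρ) < ∞` for some `ρ > 0`. -/
def fenchelOrlicz {E : Type*} [AddCommGroup E] [Module ℝ E] (Ψ : E → ℝ≥0∞) : Set (ℕ → E) :=
  {x | ∃ ρ : ℝ, 0 < ρ ∧ ∑' k, Ψ (ρ⁻¹ • x k) < ⊤}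

/-- The Luxemburg norm `inf {ρ > 0 : ∑ Ψ(xₖ / ρ) ≤ 1}`. -/
noncomputable def luxemburg {E : Type*} [AddCommGroup E] [Module ℝ E] (Ψ : E → ℝ≥0∞)
    (x : ℕ → E) : ℝ :=
  sInf {ρ : ℝ | 0 < ρ ∧ ∑' k, Ψ (ρ⁻¹ • x k) ≤ 1}

/-- A non-negative real function, regarded as an `[0, ∞]`-valued one. -/
noncomputable def toENN {E : Type*} (Φ : E → ℝ) (x : E) : ℝ≥0∞ := ENNReal.ofReal (Φ x)

/-- The Orlicz sequence space `ℓ_φ`, as a set of real sequences. -/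
noncomputable def orliczSpace (φ : ℝ → ℝ) : Set (ℕ → ℝ) := fenchelOrlicz (toENN φ)

/-- The norm `‖·‖_φ` of the Orlicz space `ℓ_φ`. -/
noncomputable def orliczNorm (φ : ℝ → ℝ) (x : ℕ → ℝ) : ℝ := luxemburg (toENN φ) x

/-! ### Rademacher type -/

/-- The space `S` with norm `N` has (Rademacher) type `p`: the average over all signs of
`N (∑ ± xᵢ)` is at most `C (∑ N(xᵢ)^p)^(1/p)`, for all finite families `xᵢ` in `S`. -/
def HasType {V : Type*} [AddCommGroup V] (S : Set V) (N : V → ℝ) (p : ℝ) : Prop :=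
  ∃ C : ℝ, ∀ (n : ℕ) (x : Fin n → V), (∀ i, x i ∈ S) →
    (1 / 2 ^ n) * ∑ ε : Fin n → Bool, N (∑ i, if ε i then x i else -x i) ≤
      C * (∑ i, N (x i) ^ p) ^ (1 / p)

/-- Non-trivial type: type `p` for some `1 < p ≤ 2`. -/
def HasNontrivialType {V : Type*} [AddCommGroup V] (S : Set V) (N : V → ℝ) : Prop :=
  ∃ p : ℝ, 1 < p ∧ p ≤ 2 ∧ HasType S N p

/-! ### The twisted sum -/

/-- The Kalton–Peck map `F(y)ₙ = yₙ θ(log(‖y‖_φ / |yₙ|))`. (For `yₙ = 0` the value is `0`,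
whatever the second factor.) -/
noncomputable def kpMap (φ θ : ℝ → ℝ) (y : ℕ → ℝ) : ℕ → ℝ :=
  fun n => y n * θ (Real.log (orliczNorm φ y / |y n|))

/-- The quasi-norm `‖(x, y)‖ = ‖y‖_φ + ‖x - F(y)‖_φ`. -/
noncomputable def twistedNorm (φ θ : ℝ → ℝ) (z : ℕ → ℝ × ℝ) : ℝ :=
  orliczNorm φ (fun n => (z n).2) +
    orliczNorm φ (fun n => (z n).1 - kpMap φ θ (fun m => (z m).2) n)

/-- The twisted sum `ℓ_φ ⊕_F ℓ_φ` as a sequence space: all sequences of pairs for which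
`‖y‖_φ + ‖x - F(y)‖_φ` is finite, that is, both `y` and `x - F(y)` lie in `ℓ_φ`. -/
noncomputable def twistedSum (φ θ : ℝ → ℝ) : Set (ℕ → ℝ × ℝ) :=
  {z | (fun n => (z n).2) ∈ orliczSpace φ ∧
    (fun n => (z n).1 - kpMap φ θ (fun m => (z m).2) n) ∈ orliczSpace φ}

/-- The finitely supported sequences of pairs, `c₀₀ × c₀₀`. -/
def cZeroZero : Set (ℕ → ℝ × ℝ) := {z | (Function.support z).Finite}

/-- The function `Φ(x, y) = φ(y) + φ(x - y θ(log(1 / |y|)))`. (For `y = 0` it is `φ(x)`,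
as `φ(0) = 0`.) -/
noncomputable def kpFunction (φ θ : ℝ → ℝ) (v : ℝ × ℝ) : ℝ :=
  φ v.2 + φ (v.1 - v.2 * θ (Real.log (1 / |v.2|)))

/-! ### Quasi-normed spaces, completions and isomorphism -/

/-- `S` is a linear subspace of `V` and `N` is a quasi-norm on it. -/
structure IsQuasiNormedSpace {V : Type*} [AddCommGroup V] [Module ℝ V] (S : Set V) (N : V → ℝ) :
    Prop where
  zero_mem : (0 : V) ∈ S
  add_mem : ∀ z ∈ S, ∀ w ∈ S, z + w ∈ S
  smul_mem : ∀ c : ℝ, ∀ z ∈ S, c • z ∈ S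
  nonneg : ∀ z ∈ S, 0 ≤ N z
  eq_zero_iff : ∀ z ∈ S, (N z = 0 ↔ z = 0)
  smul : ∀ c : ℝ, ∀ z ∈ S, N (c • z) = |c| * N z
  add_le : ∃ C : ℝ, ∀ z ∈ S, ∀ w ∈ S, N (z + w) ≤ C * (N z + N w)

/-- The quasi-normed space `(S, N)` is a completion of its subset `D`: it is complete and
contains `D` as a dense subset. -/
structure IsCompletionOf {V : Type*} [AddCommGroup V] [Module ℝ V] (D S : Set V) (N : V → ℝ) :
    Prop where
  isQuasiNormedSpace : IsQuasiNormedSpace S N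
  subset : D ⊆ S
  dense : ∀ z ∈ S, ∀ ε > 0, ∃ w ∈ D, N (z - w) < ε
  complete : ∀ u : ℕ → V, (∀ n, u n ∈ S) →
    (∀ ε > 0, ∃ n₀, ∀ m ≥ n₀, ∀ n ≥ n₀, N (u m - u n) < ε) →
    ∃ z ∈ S, Tendsto (fun n => N (u n - z)) atTop (𝓝 0)

/-- `Ψ` is a Young's function, the sequence space `(S, N)` coincides as a set with the
Fenchel–Orlicz space `ℓ_Ψ`, and the identity map is an isomorphism between them. -/
def IsFenchelOrliczVia {E : Type*} [AddCommGroup E] [Module ℝ E] (Ψ : E → ℝ≥0∞)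
    (S : Set (ℕ → E)) (N : (ℕ → E) → ℝ) : Prop :=
  IsYoungFunction Ψ ∧ S = fenchelOrlicz Ψ ∧
    ∃ c C : ℝ, 0 < c ∧ 0 < C ∧ ∀ z ∈ S, c * luxemburg Ψ z ≤ N z ∧ N z ≤ C * luxemburg Ψ z

end TwistedSum

open TwistedSum

/-!
# Twisted sums of Orlicz spaces as Fenchel–Orlicz spaces

Let `φ` be an Orlicz function such that `ℓ_φ` has type `p > 1`.

*Growth of `φ`.* Testing the type inequality on `n` disjoint blocks of equal constant entries gives
`φ(l t) ≤ M l ^ p φ(t)` for small `t` (`IsOrliczFunction.power_bound_near_zero`); testing it on `m`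
Rademacher vectors spread over `2 ^ m` blocks gives `φ(2 t) ≤ D φ(t)` for small `t`
(`IsOrliczFunction.delta_two_near_zero`). Replacing `φ` beyond `1` by an affine function plus
`t ^ p` (`regularExtension`) yields an Orlicz function `ψ` with both properties
globally. As `ψ = φ` on `[0, 1]`, the modular of `ψ` and the norm of `ℓ_φ` control each other
(`IsOrliczFunction.exists_orliczNorm_le`, `IsOrliczFunction.exists_tsum_le`).

*Quasi-convexity of `Φ`.* Given a convex combination of points `(x i, y i)` with weights `α i`, let
`ψ A = ∑ α i ψ(y i)`. Jensen's inequality and the doubling condition reduce the quasi-convexity of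
`Φ` to the estimate `|∑ α i y i (θ(log (1 / |y i|)) - θ(log (1 / A)))| ≤ c A`. This holds because
`|w| |log (|w| / A)|` is at most `A` for `|w| ≤ A`, and at most a multiple of `A ψ(w) / ψ(A)` for
`|w| > A`, by the power bound (`IsOrliczFunction.exists_defect_le`). The argument works for
combinations of any length at once, so that `Φ` is bounded by a multiple of its convex envelope `Ψ`
(`IsOrliczFunction.exists_kpFunction_le_convexEnvelope`), which is therefore a Young's function.

*Comparison of norms.* At scale `ρ` the second term of `Φ((x, y) / ρ)` is
`ψ((x - y θ(log (ρ / |y|))) / ρ)`, whereas `F(y)` involves `θ(log (‖y‖ / |y|))`. The discrepancy is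
at most `K (‖y‖ / ρ) |log (‖y‖ / ρ)| |y| / ‖y‖`, whose modular is bounded as long as `‖y‖ / ρ` is.
Hence the modular of `Φ` at scale `ρ` is bounded if and only if `‖(x, y)‖` is at most a multiple of
`ρ` (`IsOrliczFunction.isFenchelOrliczVia`).

*Completion.* The Luxemburg norm is a norm, so the quasi-triangle inequality for the twisted sum
follows from the equivalence of norms; completeness and the density of the finitely supported
sequences follow from the corresponding facts about `ℓ_Ψ`, where `Ψ` is continuous, satisfies the
doubling condition and has bounded sublevel sets (`IsFenchelOrliczVia.isCompletionOf`). The powers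
`|t| ^ p` satisfy both growth conditions, so for `Z_p` one may take `ψ = φ`.
-/

namespace TwistedSum

/-! ### Orlicz functions -/

namespace IsOrliczFunction

variable {φ : ℝ → ℝ}

lemma map_abs (h : IsOrliczFunction φ) (x : ℝ) : φ |x| = φ x := by
  rcases abs_choice x with hx | hx <;> rw [hx]
  exact h.even x

lemma mono_abs (h : IsOrliczFunction φ) {x y : ℝ} (hxy : |x| ≤ |y|) : φ x ≤ φ y := by
  rw [← h.map_abs x, ← h.map_abs y]
  exact h.monotoneOn (abs_nonneg x) (abs_nonneg y) hxy

lemma nonneg (h : IsOrliczFunction φ) (x : ℝ) : 0 ≤ φ x := by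
  rw [← h.map_zero]
  exact h.mono_abs (by simp)

lemma map_le_map (h : IsOrliczFunction φ) {x y : ℝ} (hx : 0 ≤ x) (hxy : x ≤ y) : φ x ≤ φ y :=
  h.monotoneOn hx (hx.trans hxy) hxy

lemma eq_zero_iff (h : IsOrliczFunction φ) {x : ℝ} : φ x = 0 ↔ x = 0 := by
  refine ⟨fun hx => ?_, fun hx => hx ▸ h.map_zero⟩
  by_contra hne
  have := h.pos |x| (abs_pos.2 hne)
  rw [h.map_abs] at this
  exact this.ne' hx

lemma convexOn_univ (h : IsOrliczFunction φ) : ConvexOn ℝ univ φ := by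
  refine ⟨convex_univ, fun x _ y _ a b ha hb hab => ?_⟩
  have h1 : φ (a • x + b • y) ≤ φ (a • |x| + b • |y|) := by
    apply h.mono_abs
    simp only [smul_eq_mul]
    rw [abs_of_nonneg (by positivity : (0 : ℝ) ≤ a * |x| + b * |y|)]
    calc |a * x + b * y| ≤ |a * x| + |b * y| := abs_add_le _ _
      _ = a * |x| + b * |y| := by rw [abs_mul, abs_mul, abs_of_nonneg ha, abs_of_nonneg hb]
  have h2 := h.convexOn.2 (abs_nonneg x) (abs_nonneg y) ha hb hab
  rw [h.map_abs, h.map_abs] at h2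
  exact h1.trans h2

lemma continuous (h : IsOrliczFunction φ) : Continuous φ :=
  continuousOn_univ.1 (h.convexOn_univ.continuousOn isOpen_univ)

lemma exists_eq (h : IsOrliczFunction φ) {B : ℝ} (hB : 0 ≤ B) : ∃ A, 0 ≤ A ∧ φ A = B := by
  obtain ⟨R, hR0, hR⟩ := ((eventually_ge_atTop (0 : ℝ)).and
    (h.tendsto_atTop.eventually_ge_atTop B)).exists
  obtain ⟨A, hA, hAB⟩ := intermediate_value_Icc hR0 h.continuous.continuousOn
    (show B ∈ Icc (φ 0) (φ R) from ⟨by rwa [h.map_zero], hR⟩)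
  exact ⟨A, hA.1, hAB⟩

lemma le_of_map_le (h : IsOrliczFunction φ) (B : ℝ) : ∃ R, 1 ≤ R ∧ ∀ x, φ x ≤ B → |x| ≤ R := by
  obtain ⟨R, hR0, hR⟩ := ((eventually_ge_atTop (1 : ℝ)).and
    (h.tendsto_atTop.eventually_gt_atTop B)).exists
  refine ⟨R, hR0, fun x hx => ?_⟩
  by_contra! hlt
  have : φ R ≤ φ x := h.mono_abs (by rw [abs_of_nonneg (by linarith)]; exact hlt.le)
  linarith

lemma exists_map_mul_le (h : IsOrliczFunction φ) (h2 : DeltaTwo φ) (c : ℝ) :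
    ∃ C, 1 ≤ C ∧ ∀ x, φ (c * x) ≤ C * φ x := by
  obtain ⟨D, hD, hDx⟩ := h2
  have hD' : ∀ x, φ (2 * x) ≤ max D 1 * φ x := fun x => by
    have := hDx |x| (abs_nonneg x)
    rw [h.map_abs, ← h.map_abs (2 * |x|), abs_mul, abs_abs, ← abs_mul, h.map_abs] at this
    exact this.trans (mul_le_mul_of_nonneg_right (le_max_left _ _) (h.nonneg x))
  have hpow : ∀ n : ℕ, ∀ x, φ (2 ^ n * x) ≤ (max D 1) ^ n * φ x := by
    intro n
    induction n with
    | zero => intro x; simp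
    | succ n ih =>
      intro x
      calc φ (2 ^ (n + 1) * x) = φ (2 * (2 ^ n * x)) := by ring_nf
        _ ≤ max D 1 * φ (2 ^ n * x) := hD' _
        _ ≤ max D 1 * ((max D 1) ^ n * φ x) :=
          mul_le_mul_of_nonneg_left (ih x) (by positivity)
        _ = _ := by ring
  obtain ⟨n, hn⟩ := pow_unbounded_of_one_lt |c| (one_lt_two : (1 : ℝ) < 2)
  refine ⟨(max D 1) ^ n, one_le_pow₀ (le_max_right _ _), fun x => le_trans ?_ (hpow n x)⟩
  apply h.mono_abs
  rw [abs_mul, abs_mul, abs_of_pos (by positivity : (0 : ℝ) < 2 ^ n)]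
  gcongr

lemma exists_map_add_le (h : IsOrliczFunction φ) (h2 : DeltaTwo φ) :
    ∃ C, 1 ≤ C ∧ ∀ x y, φ (x + y) ≤ C * (φ x + φ y) := by
  obtain ⟨C, hC, hCx⟩ := h.exists_map_mul_le h2 2
  refine ⟨C, hC, fun x y => ?_⟩
  have := h.convexOn_univ.2 (mem_univ (2 * x)) (mem_univ (2 * y))
    (by norm_num : (0 : ℝ) ≤ 1 / 2) (by norm_num : (0 : ℝ) ≤ 1 / 2) (by norm_num)
  have e : (1 / 2 : ℝ) • (2 * x) + (1 / 2 : ℝ) • (2 * y) = x + y := by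
    simp only [smul_eq_mul]; ring
  rw [e] at this
  simp only [smul_eq_mul] at this
  have h3 := hCx x
  have h4 := hCx y
  have h5 := h.nonneg x
  have h6 := h.nonneg y
  nlinarith

end IsOrliczFunction

/-- A real-valued convex function with the remaining properties of a Young's function is one. -/
lemma isYoungFunction_toENN {E : Type*} [AddCommGroup E] [Module ℝ E] {Φ : E → ℝ}
    (h0 : ∀ x, 0 ≤ Φ x) (he : ∀ x, Φ (-x) = Φ x) (hc : ConvexOn ℝ univ Φ) (hz : Φ 0 = 0)
    (ht : ∀ x, x ≠ 0 → Tendsto (fun t : ℝ => Φ (t • x)) atTop atTop) :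
    IsYoungFunction (toENN Φ) where
  even x := by simp [toENN, he]
  convex x y a b hab := by
    have := hc.2 (mem_univ x) (mem_univ y) a.coe_nonneg b.coe_nonneg
      (by rw [← NNReal.coe_add, hab, NNReal.coe_one])
    calc toENN Φ ((a : ℝ) • x + (b : ℝ) • y)
        ≤ ENNReal.ofReal ((a : ℝ) • Φ x + (b : ℝ) • Φ y) := ENNReal.ofReal_le_ofReal this
      _ = _ := by
        simp only [smul_eq_mul, toENN]
        rw [ENNReal.ofReal_add (mul_nonneg a.coe_nonneg (h0 x))
          (mul_nonneg b.coe_nonneg (h0 y)),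
          ENNReal.ofReal_mul a.coe_nonneg, ENNReal.ofReal_mul b.coe_nonneg, ENNReal.ofReal_coe_nnreal,
          ENNReal.ofReal_coe_nnreal]
  map_zero := by simp [toENN, hz]
  tendsto_top x hx := ENNReal.tendsto_ofReal_atTop.comp (ht x hx)

lemma IsOrliczFunction.isYoungFunction {φ : ℝ → ℝ} (h : IsOrliczFunction φ) :
    IsYoungFunction (toENN φ) := by
  refine isYoungFunction_toENN h.nonneg h.even h.convexOn_univ h.map_zero fun x hx => ?_
  have e : (fun t : ℝ => φ (t • x)) =ᶠ[atTop] fun t => φ (t * |x|) := by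
    filter_upwards [eventually_ge_atTop (0 : ℝ)] with t ht
    rw [smul_eq_mul, ← h.map_abs (t * x), abs_mul, abs_of_nonneg ht]
  rw [tendsto_congr' e]
  exact h.tendsto_atTop.comp (tendsto_id.atTop_mul_const (abs_pos.2 hx))

/-! ### The Luxemburg norm of a Young's function -/

section Luxemburg

variable {E : Type*} [AddCommGroup E] [Module ℝ E] {Ψ : E → ℝ≥0∞}

lemma IsYoungFunction.smul_le (h : IsYoungFunction Ψ) {a : ℝ} (ha : 0 ≤ a) (ha1 : a ≤ 1) (x : E) :
    Ψ (a • x) ≤ ENNReal.ofReal a * Ψ x := by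
  have h1 : (⟨a, ha⟩ : ℝ≥0) + ⟨1 - a, sub_nonneg.2 ha1⟩ = 1 :=
    NNReal.eq (by change a + (1 - a) = 1; ring)
  have := h.convex x 0 _ _ h1
  rw [h.map_zero, smul_zero, add_zero, mul_zero, add_zero] at this
  rw [ENNReal.ofReal_eq_coe_nnreal ha]
  exact this

lemma IsYoungFunction.tsum_le_mul (h : IsYoungFunction Ψ) {ρ σ : ℝ} (hρ : 0 < ρ) (hρσ : ρ ≤ σ)
    (x : ℕ → E) :
    ∑' k, Ψ (σ⁻¹ • x k) ≤ ENNReal.ofReal (ρ / σ) * ∑' k, Ψ (ρ⁻¹ • x k) := by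
  have hσ : 0 < σ := hρ.trans_le hρσ
  rw [← ENNReal.tsum_mul_left]
  refine ENNReal.tsum_le_tsum fun k => ?_
  have := h.smul_le (div_nonneg hρ.le hσ.le) ((div_le_one hσ).2 hρσ) (ρ⁻¹ • x k)
  rwa [smul_smul, show ρ / σ * ρ⁻¹ = σ⁻¹ by field_simp] at this

lemma IsYoungFunction.tsum_mono (h : IsYoungFunction Ψ) {ρ σ : ℝ} (hρ : 0 < ρ) (hρσ : ρ ≤ σ)
    (x : ℕ → E) : ∑' k, Ψ (σ⁻¹ • x k) ≤ ∑' k, Ψ (ρ⁻¹ • x k) := by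
  refine (h.tsum_le_mul hρ hρσ x).trans (mul_le_of_le_one_left zero_le ?_)
  rw [ENNReal.ofReal_le_one]
  exact (div_le_one (hρ.trans_le hρσ)).2 hρσ

lemma luxemburg_nonneg (x : ℕ → E) : 0 ≤ luxemburg Ψ x :=
  Real.sInf_nonneg fun _ hρ => hρ.1.le

lemma bddBelow_luxemburg (x : ℕ → E) :
    BddBelow {ρ : ℝ | 0 < ρ ∧ ∑' k, Ψ (ρ⁻¹ • x k) ≤ 1} :=
  ⟨0, fun _ hρ => hρ.1.le⟩

lemma luxemburg_le {x : ℕ → E} {ρ : ℝ} (hρ : 0 < ρ) (h : ∑' k, Ψ (ρ⁻¹ • x k) ≤ 1) :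
    luxemburg Ψ x ≤ ρ :=
  csInf_le (bddBelow_luxemburg x) ⟨hρ, h⟩

lemma mem_fenchelOrlicz_of_le_one {x : ℕ → E} {ρ : ℝ} (hρ : 0 < ρ)
    (h : ∑' k, Ψ (ρ⁻¹ • x k) ≤ 1) : x ∈ fenchelOrlicz Ψ :=
  ⟨ρ, hρ, h.trans_lt ENNReal.one_lt_top⟩

lemma IsYoungFunction.tsum_mul_le_one (h : IsYoungFunction Ψ) {x : ℕ → E} {ρ D : ℝ} (hρ : 0 < ρ)
    (hD : 1 ≤ D) (hx : ∑' k, Ψ (ρ⁻¹ • x k) ≤ ENNReal.ofReal D) :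
    ∑' k, Ψ ((D * ρ)⁻¹ • x k) ≤ 1 := by
  have hD0 : 0 < D := by linarith
  refine (h.tsum_le_mul hρ (le_mul_of_one_le_left hρ.le hD) x).trans ?_
  calc _ ≤ ENNReal.ofReal (ρ / (D * ρ)) * ENNReal.ofReal D := by gcongr
    _ = 1 := by
      rw [← ENNReal.ofReal_mul (by positivity)]
      have : ρ / (D * ρ) * D = 1 := by field_simp
      rw [this, ENNReal.ofReal_one]

lemma IsYoungFunction.exists_tsum_le_one (h : IsYoungFunction Ψ) {x : ℕ → E}
    (hx : x ∈ fenchelOrlicz Ψ) : ∃ ρ : ℝ, 0 < ρ ∧ ∑' k, Ψ (ρ⁻¹ • x k) ≤ 1 := by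
  obtain ⟨ρ, hρ, hs⟩ := hx
  refine ⟨max (∑' k, Ψ (ρ⁻¹ • x k)).toReal 1 * ρ, by positivity,
    h.tsum_mul_le_one hρ (le_max_right _ _) ?_⟩
  exact (ENNReal.ofReal_toReal hs.ne).symm.trans_le (ENNReal.ofReal_le_ofReal (le_max_left _ _))

lemma IsYoungFunction.tsum_le_one_of_luxemburg_lt (h : IsYoungFunction Ψ) {x : ℕ → E}
    (hx : x ∈ fenchelOrlicz Ψ) {ρ : ℝ} (hρ : luxemburg Ψ x < ρ) :
    ∑' k, Ψ (ρ⁻¹ • x k) ≤ 1 := by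
  obtain ⟨σ, ⟨hσ, hs⟩, hlt⟩ := exists_lt_of_csInf_lt (h.exists_tsum_le_one hx) hρ
  exact (h.tsum_mono hσ hlt.le x).trans hs

lemma le_luxemburg {x : ℕ → E} (h : IsYoungFunction Ψ) (hx : x ∈ fenchelOrlicz Ψ) {c : ℝ}
    (hc : ∀ ρ : ℝ, 0 < ρ → ∑' k, Ψ (ρ⁻¹ • x k) ≤ 1 → c ≤ ρ) : c ≤ luxemburg Ψ x :=
  le_csInf (h.exists_tsum_le_one hx) fun ρ hρ => hc ρ hρ.1 hρ.2

lemma IsYoungFunction.luxemburg_zero (h : IsYoungFunction Ψ) :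
    luxemburg Ψ (0 : ℕ → E) = 0 := by
  refine le_antisymm (le_of_forall_pos_le_add fun ε hε => ?_) (luxemburg_nonneg _)
  rw [zero_add]
  exact luxemburg_le hε (by simp [h.map_zero])

lemma IsYoungFunction.map_abs_smul (h : IsYoungFunction Ψ) (c : ℝ) (v : E) :
    Ψ (|c| • v) = Ψ (c • v) := by
  rcases abs_choice c with hc | hc <;> rw [hc]
  rw [neg_smul, h.even]

lemma IsYoungFunction.luxemburg_smul (h : IsYoungFunction Ψ) (c : ℝ) (x : ℕ → E) :
    luxemburg Ψ (c • x) = |c| * luxemburg Ψ x := by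
  rcases eq_or_ne c 0 with rfl | hc
  · simp [h.luxemburg_zero]
  have hc' : 0 < |c| := abs_pos.2 hc
  unfold luxemburg
  rw [← smul_eq_mul, ← Real.sInf_smul_of_nonneg hc'.le]
  congr 1
  ext ρ
  rw [Set.mem_smul_set_iff_inv_smul_mem₀ hc'.ne']
  simp only [mem_ofPred_eq, Pi.smul_apply, smul_eq_mul]
  refine and_congr (mul_pos_iff_of_pos_left (inv_pos.2 hc')).symm ?_
  have : ∀ k, Ψ (ρ⁻¹ • c • x k) = Ψ ((|c|⁻¹ * ρ)⁻¹ • x k) := fun k => by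
    rw [smul_smul, ← h.map_abs_smul, ← h.map_abs_smul (_)⁻¹]
    congr 2
    rw [mul_inv, inv_inv, abs_mul, abs_mul, abs_abs, mul_comm]
  simp_rw [this]

lemma IsYoungFunction.smul_mem (h : IsYoungFunction Ψ) (c : ℝ) {x : ℕ → E}
    (hx : x ∈ fenchelOrlicz Ψ) : c • x ∈ fenchelOrlicz Ψ := by
  obtain ⟨ρ, hρ, hs⟩ := hx
  rcases eq_or_ne c 0 with rfl | hc
  · exact ⟨1, one_pos, by simp [h.map_zero]⟩
  have hc' : 0 < |c| := abs_pos.2 hc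
  refine ⟨|c| * ρ, by positivity, ?_⟩
  convert hs using 3 with k
  rw [Pi.smul_apply, smul_smul, ← h.map_abs_smul, ← h.map_abs_smul ρ⁻¹]
  congr 2
  rw [abs_mul, abs_inv, abs_mul, abs_abs, abs_inv]
  field_simp

lemma IsYoungFunction.tsum_add_le_one (h : IsYoungFunction Ψ) {x y : ℕ → E} {ρ σ : ℝ} (hρ : 0 < ρ)
    (hσ : 0 < σ) (hx : ∑' k, Ψ (ρ⁻¹ • x k) ≤ 1) (hy : ∑' k, Ψ (σ⁻¹ • y k) ≤ 1) :
    ∑' k, Ψ ((ρ + σ)⁻¹ • (x + y) k) ≤ 1 := by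
  have hs : 0 < ρ + σ := by positivity
  set a : ℝ≥0 := ⟨ρ / (ρ + σ), by positivity⟩ with ha
  set b : ℝ≥0 := ⟨σ / (ρ + σ), by positivity⟩ with hb
  have hab : a + b = 1 := NNReal.eq (by
    change ρ / (ρ + σ) + σ / (ρ + σ) = 1
    field_simp)
  have hk : ∀ k, Ψ ((ρ + σ)⁻¹ • (x + y) k) ≤ a * Ψ (ρ⁻¹ • x k) + b * Ψ (σ⁻¹ • y k) := fun k => by
    have := h.convex (ρ⁻¹ • x k) (σ⁻¹ • y k) a b hab
    convert this using 2
    rw [smul_smul, smul_smul, Pi.add_apply, smul_add]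
    congr 2
    · change _ = ρ / (ρ + σ) * ρ⁻¹
      field_simp
    · change _ = σ / (ρ + σ) * σ⁻¹
      field_simp
  calc _ ≤ ∑' k, (a * Ψ (ρ⁻¹ • x k) + b * Ψ (σ⁻¹ • y k)) := ENNReal.tsum_le_tsum hk
    _ = a * ∑' k, Ψ (ρ⁻¹ • x k) + b * ∑' k, Ψ (σ⁻¹ • y k) := by
      rw [ENNReal.tsum_add, ENNReal.tsum_mul_left, ENNReal.tsum_mul_left]
    _ ≤ a * 1 + b * 1 := by gcongr
    _ = 1 := by rw [mul_one, mul_one]; exact_mod_cast hab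

lemma IsYoungFunction.add_mem (h : IsYoungFunction Ψ) {x y : ℕ → E}
    (hx : x ∈ fenchelOrlicz Ψ) (hy : y ∈ fenchelOrlicz Ψ) : x + y ∈ fenchelOrlicz Ψ := by
  obtain ⟨ρ, hρ, hρx⟩ := h.exists_tsum_le_one hx
  obtain ⟨σ, hσ, hσy⟩ := h.exists_tsum_le_one hy
  exact mem_fenchelOrlicz_of_le_one (add_pos hρ hσ) (h.tsum_add_le_one hρ hσ hρx hσy)

lemma IsYoungFunction.luxemburg_add_le (h : IsYoungFunction Ψ) {x y : ℕ → E}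
    (hx : x ∈ fenchelOrlicz Ψ) (hy : y ∈ fenchelOrlicz Ψ) :
    luxemburg Ψ (x + y) ≤ luxemburg Ψ x + luxemburg Ψ y := by
  refine le_of_forall_pos_le_add fun ε hε => ?_
  have h1 : luxemburg Ψ x < luxemburg Ψ x + ε / 2 := by linarith
  have h2 : luxemburg Ψ y < luxemburg Ψ y + ε / 2 := by linarith
  have hp := (luxemburg_nonneg (Ψ := Ψ) x).trans_lt h1
  have hq := (luxemburg_nonneg (Ψ := Ψ) y).trans_lt h2
  have := luxemburg_le (add_pos hp hq) (h.tsum_add_le_one hp hq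
    (h.tsum_le_one_of_luxemburg_lt hx h1) (h.tsum_le_one_of_luxemburg_lt hy h2))
  linarith

end Luxemburg

/-! ### Consequences of type for the growth of an Orlicz function near zero -/

/-- Some choice of signs does at least as well as the average over all signs. -/
lemma HasType.exists_sign {V : Type*} [AddCommGroup V] {S : Set V} {N : V → ℝ} {p : ℝ}
    (h : HasType S N p) (hp : 0 < p) (hN : ∀ x, 0 ≤ N x) :
    ∃ C : ℝ, 1 ≤ C ∧ ∀ (n : ℕ) (x : Fin n → V), (∀ i, x i ∈ S) → (∀ i, N (x i) ≤ 1) →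
      ∃ ε : Fin n → Bool, N (∑ i, if ε i then x i else -x i) ≤ C * (n : ℝ) ^ (1 / p) := by
  obtain ⟨C, hC⟩ := h
  refine ⟨max C 1, le_max_right _ _, fun n x hx hx1 => ?_⟩
  by_contra! hlt
  have h1 := hC n x hx
  have h2 : (∑ i, N (x i) ^ p) ≤ n := by
    calc (∑ i, N (x i) ^ p) ≤ ∑ _i : Fin n, (1 : ℝ) :=
          Finset.sum_le_sum fun i _ => Real.rpow_le_one (hN _) (hx1 i) hp.le
      _ = n := by simp
  have h0 : 0 ≤ ∑ i, N (x i) ^ p := Finset.sum_nonneg fun i _ => Real.rpow_nonneg (hN _) _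
  have h3 : C * (∑ i, N (x i) ^ p) ^ (1 / p) ≤ max C 1 * (n : ℝ) ^ (1 / p) :=
    mul_le_mul (le_max_left _ _) (Real.rpow_le_rpow h0 h2 (by positivity))
      (Real.rpow_nonneg h0 _) (by positivity)
  have h4 : ∑ _ε : Fin n → Bool, max C 1 * (n : ℝ) ^ (1 / p) <
      ∑ ε : Fin n → Bool, N (∑ i, if ε i then x i else -x i) :=
    Finset.sum_lt_sum_of_nonempty Finset.univ_nonempty fun ε _ => hlt ε
  have h5 : (2 : ℝ) ^ n * (max C 1 * (n : ℝ) ^ (1 / p)) <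
      ∑ ε : Fin n → Bool, N (∑ i, if ε i then x i else -x i) := by
    simpa using h4
  have h6 : (0 : ℝ) < 2 ^ n := by positivity
  rw [one_div, inv_mul_le_iff₀ h6] at h1
  nlinarith

lemma mem_fenchelOrlicz_of_finite_support {E : Type*} [AddCommGroup E] [Module ℝ E] {Φ : E → ℝ}
    (h0 : Φ 0 = 0) {x : ℕ → E} (hx : (Function.support x).Finite) :
    x ∈ fenchelOrlicz (toENN Φ) := by
  refine ⟨1, one_pos, ?_⟩
  rw [tsum_eq_sum (s := hx.toFinset)]
  · exact ENNReal.sum_lt_top.2 fun k _ => ENNReal.ofReal_lt_top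
  · intro k hk
    have : x k = 0 := by simpa using hk
    simp [this, toENN, h0]

section Blocks

variable {φ : ℝ → ℝ} (h : IsOrliczFunction φ)
include h

lemma IsOrliczFunction.orliczNorm_le_one_of_card {x : ℕ → ℝ} {t : ℝ} {s : Finset ℕ}
    (hs : ∀ k ∉ s, x k = 0) (hx : ∀ k, |x k| ≤ |t|) (ht : s.card * φ t ≤ 1) :
    orliczNorm φ x ≤ 1 := by
  refine luxemburg_le one_pos ?_
  rw [tsum_eq_sum (s := s)]
  · calc ∑ k ∈ s, toENN φ ((1 : ℝ)⁻¹ • x k) ≤ ∑ _k ∈ s, ENNReal.ofReal (φ t) := by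
          refine Finset.sum_le_sum fun k _ => ENNReal.ofReal_le_ofReal (h.mono_abs ?_)
          simpa using hx k
      _ = ENNReal.ofReal (s.card * φ t) := by
          rw [Finset.sum_const, nsmul_eq_mul, ENNReal.ofReal_mul (by positivity),
            ENNReal.ofReal_natCast]
      _ ≤ 1 := by rwa [ENNReal.ofReal_le_one]
  · intro k hk
    simp [hs k hk, toENN, h.map_zero]

lemma IsOrliczFunction.card_mul_le_one {x : ℕ → ℝ} (hx : x ∈ orliczSpace φ) {t ρ : ℝ}
    (hρ : orliczNorm φ x < ρ) {s : Finset ℕ} (hs : ∀ k ∈ s, |t| ≤ |x k|) :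
    s.card * φ (ρ⁻¹ * t) ≤ 1 := by
  have h1 := h.isYoungFunction.tsum_le_one_of_luxemburg_lt hx hρ
  rw [← ENNReal.ofReal_le_one]
  refine le_trans ?_ h1
  refine le_trans ?_ (ENNReal.sum_le_tsum s)
  calc ENNReal.ofReal (s.card * φ (ρ⁻¹ * t)) = ∑ _k ∈ s, ENNReal.ofReal (φ (ρ⁻¹ * t)) := by
        rw [Finset.sum_const, nsmul_eq_mul, ENNReal.ofReal_mul (by positivity),
            ENNReal.ofReal_natCast]
    _ ≤ _ := by
        refine Finset.sum_le_sum fun k hk => ENNReal.ofReal_le_ofReal (h.mono_abs ?_)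
        rw [smul_eq_mul, abs_mul, abs_mul]
        exact mul_le_mul_of_nonneg_left (hs k hk) (abs_nonneg _)

/-- The type inequality for `n` disjoint blocks of length `b` on which the vectors are constant. -/
lemma IsOrliczFunction.blocks_of_hasType {p C : ℝ} (hC : 1 ≤ C)
    (hT : ∀ (n : ℕ) (x : Fin n → ℕ → ℝ), (∀ i, x i ∈ orliczSpace φ) →
      (∀ i, orliczNorm φ (x i) ≤ 1) →
      ∃ ε : Fin n → Bool, orliczNorm φ (∑ i, if ε i then x i else -x i) ≤ C * (n : ℝ) ^ (1 / p))
    {n b : ℕ} (hn : 0 < n) (hb : 0 < b) {t : ℝ} (ht : b * φ t ≤ 1) :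
    (n * b : ℕ) * φ ((2 * C * (n : ℝ) ^ (1 / p))⁻¹ * t) ≤ 1 := by
  set x : Fin n → ℕ → ℝ := fun i k => if k / b = i then t else 0 with hxdef
  have hmem : ∀ (i : Fin n) (k : ℕ), k ∉ Finset.Ico (i * b : ℕ) (i * b + b) → x i k = 0 := by
    intro i k hk
    simp only [hxdef]
    rw [if_neg]
    intro hki
    apply hk
    rw [Finset.mem_Ico]
    constructor
    · rw [← hki]; exact Nat.div_mul_le_self k b
    · rw [← hki]; exact Nat.lt_div_mul_add hb
  have hle : ∀ (i : Fin n) (k : ℕ), |x i k| ≤ |t| := fun i k => by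
    simp only [hxdef]
    split_ifs
    · exact le_rfl
    · simp
  have hfin : ∀ i, (Function.support (x i)).Finite := fun i =>
    (Finset.finite_toSet (Finset.Ico (i * b : ℕ) (i * b + b))).subset fun k hk => by
      by_contra hk'
      exact hk (hmem i k hk')
  have hin : ∀ i, x i ∈ orliczSpace φ := fun i =>
    mem_fenchelOrlicz_of_finite_support h.map_zero (hfin i)
  obtain ⟨ε, hε⟩ := hT n x hin fun i => h.orliczNorm_le_one_of_card (hmem i) (hle i) (by simpa)
  have hpos : (0 : ℝ) < C * (n : ℝ) ^ (1 / p) := by positivity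
  have hzin : (∑ i, if ε i then x i else -x i) ∈ orliczSpace φ := by
    refine Finset.sum_induction _ (· ∈ orliczSpace φ)
      (fun _ _ ha hb => h.isYoungFunction.add_mem ha hb)
      (mem_fenchelOrlicz_of_finite_support h.map_zero (by simp)) fun i _ => ?_
    split_ifs
    · exact hin i
    · have := h.isYoungFunction.smul_mem (-1) (hin i)
      rwa [neg_one_smul] at this
  have hlt : orliczNorm φ (∑ i, if ε i then x i else -x i) < 2 * C * (n : ℝ) ^ (1 / p) := by
    linarith
  have := h.card_mul_le_one hzin hlt (t := t) (s := Finset.range (n * b)) ?_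
  · simpa using this
  intro k hk
  have hkn : k / b < n := by
    rw [Nat.div_lt_iff_lt_mul hb]; exact Finset.mem_range.1 hk
  rw [Finset.sum_apply, Finset.sum_eq_single ⟨k / b, hkn⟩]
  · split_ifs <;> simp [hxdef]
  · intro j _ hj
    have : k / b ≠ j := fun e => hj (Fin.ext e.symm)
    split_ifs <;> simp [hxdef, this]
  · simp

/-- The type inequality for the `m` Rademacher vectors over `2 ^ m` blocks of length `b`, which
behave like the unit vectors of `ℓ_1 ^ m` if `φ (2 t)` is large compared with `φ t`. -/
lemma IsOrliczFunction.rademacher_of_hasType {p C : ℝ} (hC : 1 ≤ C)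
    (hT : ∀ (n : ℕ) (x : Fin n → ℕ → ℝ), (∀ i, x i ∈ orliczSpace φ) →
      (∀ i, orliczNorm φ (x i) ≤ 1) →
      ∃ ε : Fin n → Bool, orliczNorm φ (∑ i, if ε i then x i else -x i) ≤ C * (n : ℝ) ^ (1 / p))
    {m b : ℕ} (hm : 0 < m) (hb : 0 < b) {t : ℝ} (ht : (2 ^ m * b : ℕ) * φ t ≤ 1) :
    b * φ ((2 * C * (m : ℝ) ^ (1 / p))⁻¹ * (m * t)) ≤ 1 := by
  set x : Fin m → ℕ → ℝ := fun i k =>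
    if k < 2 ^ m * b then (if (k / b).testBit i then t else -t) else 0 with hxdef
  have hmem : ∀ (i : Fin m) (k : ℕ), k ∉ Finset.range (2 ^ m * b) → x i k = 0 := by
    intro i k hk
    simp only [hxdef]
    rw [if_neg (by simpa using hk)]
  have hle : ∀ (i : Fin m) (k : ℕ), |x i k| ≤ |t| := fun i k => by
    simp only [hxdef]
    split_ifs <;> simp
  have hfin : ∀ i, (Function.support (x i)).Finite := fun i =>
    (Finset.finite_toSet (Finset.range (2 ^ m * b))).subset fun k hk => by
      by_contra hk'
      exact hk (hmem i k hk')
  have hin : ∀ i, x i ∈ orliczSpace φ := fun i =>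
    mem_fenchelOrlicz_of_finite_support h.map_zero (hfin i)
  obtain ⟨ε, hε⟩ := hT m x hin fun i =>
    h.orliczNorm_le_one_of_card (hmem i) (hle i) (by simpa using ht)
  have hpos : (0 : ℝ) < C * (m : ℝ) ^ (1 / p) := by positivity
  have hzin : (∑ i, if ε i then x i else -x i) ∈ orliczSpace φ := by
    refine Finset.sum_induction _ (· ∈ orliczSpace φ)
      (fun _ _ ha hb => h.isYoungFunction.add_mem ha hb)
      (mem_fenchelOrlicz_of_finite_support h.map_zero (by simp)) fun i _ => ?_
    split_ifs
    · exact hin i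
    · have := h.isYoungFunction.smul_mem (-1) (hin i)
      rwa [neg_one_smul] at this
  have hlt : orliczNorm φ (∑ i, if ε i then x i else -x i) < 2 * C * (m : ℝ) ^ (1 / p) := by
    linarith
  -- On the block whose index has binary digits `ε`, all the summands agree.
  set j := Nat.ofBits ε with hj
  have hj2 : j < 2 ^ m := Nat.ofBits_lt_two_pow ε
  have := h.card_mul_le_one hzin hlt (t := m * t) (s := Finset.Ico (j * b) (j * b + b)) ?_
  · simpa using this
  intro k hk
  rw [Finset.mem_Ico] at hk
  have hkj : k / b = j := by
    rw [Nat.div_eq_iff hb]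
    omega
  have hk2 : k < 2 ^ m * b := (Nat.div_lt_iff_lt_mul hb).1 (hkj ▸ hj2)
  have hval : ∀ i : Fin m, (if ε i then x i else -x i) k = t := fun i => by
    have hbit : j.testBit i = ε i := by
      rw [hj, Nat.testBit_ofBits_lt ε i i.2]
    simp only [hxdef]
    cases hεi : ε i <;> simp [hk2, hkj, hbit, hεi]
  rw [Finset.sum_apply, Finset.sum_congr rfl fun i _ => hval i]
  simp

end Blocks

lemma exists_nat_mul_near_one {u : ℝ} (hu : 0 < u) (hu1 : u ≤ 1) :
    ∃ b : ℕ, 0 < b ∧ b * u ≤ 1 ∧ 1 ≤ 2 * b * u := by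
  have h1 : 1 ≤ u⁻¹ := (one_le_inv₀ hu).2 hu1
  have hb : 1 ≤ ⌊u⁻¹⌋₊ := (Nat.one_le_floor_iff _).2 h1
  have hb' : (1 : ℝ) ≤ ⌊u⁻¹⌋₊ := by exact_mod_cast hb
  refine ⟨⌊u⁻¹⌋₊, hb, ?_, ?_⟩
  · have := Nat.floor_le (inv_pos.2 hu).le
    calc (⌊u⁻¹⌋₊ : ℝ) * u ≤ u⁻¹ * u := by gcongr
      _ = 1 := inv_mul_cancel₀ hu.ne'
  · have := Nat.lt_floor_add_one u⁻¹
    calc (1 : ℝ) = u⁻¹ * u := (inv_mul_cancel₀ hu.ne').symm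
      _ ≤ 2 * ⌊u⁻¹⌋₊ * u := by gcongr; linarith

lemma IsOrliczFunction.power_bound_near_zero {φ : ℝ → ℝ} (h : IsOrliczFunction φ) {p : ℝ}
    (hp : 1 < p) (hT : HasType (orliczSpace φ) (orliczNorm φ) p) :
    ∃ M > 0, ∀ l t : ℝ, 0 < l → 0 < t → φ t ≤ 1 → l ≤ 1 → φ (l * t) ≤ M * l ^ p * φ t := by
  have hp0 : 0 < p := by linarith
  obtain ⟨C, hC, hT⟩ := hT.exists_sign hp0 luxemburg_nonneg
  have hC0 : 0 < C := by linarith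
  refine ⟨4 * (2 * C) ^ p, by positivity, fun l t hl ht ht1 hl1 => ?_⟩
  have hφt := h.pos t ht
  have hφ0 := h.nonneg (l * t)
  have hv : 0 < (2 * C * l) ^ p := by positivity
  have e : 4 * (2 * C) ^ p * l ^ p * φ t = 4 * (2 * C * l) ^ p * φ t := by
    rw [Real.mul_rpow (by positivity) hl.le]; ring
  rw [e]
  rcases le_or_gt ((2 * C * l) ^ p) 1 with hv1 | hv1
  · obtain ⟨n, hn, hn1, hn2⟩ := exists_nat_mul_near_one hv hv1
    obtain ⟨b, hb, hb1, hb2⟩ := exists_nat_mul_near_one hφt ht1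
    have hn' : (0 : ℝ) < n := by exact_mod_cast hn
    have hb' : (0 : ℝ) < b := by exact_mod_cast hb
    have key := h.blocks_of_hasType hC hT hn hb hb1
    have hnp : (0 : ℝ) < (n : ℝ) ^ (1 / p) := by positivity
    have hl' : l ≤ (2 * C * (n : ℝ) ^ (1 / p))⁻¹ := by
      rw [le_inv_comm₀ hl (by positivity)]
      have h1 : ((n : ℝ) * (2 * C * l) ^ p) ^ (1 / p) ≤ 1 :=
        Real.rpow_le_one (by positivity) hn1 (by positivity)
      rw [Real.mul_rpow hn'.le hv.le, ← Real.rpow_mul (by positivity),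
        mul_one_div_cancel hp0.ne', Real.rpow_one] at h1
      rw [← one_div, le_div_iff₀ hl]
      linarith
    have h2 : φ (l * t) ≤ φ ((2 * C * (n : ℝ) ^ (1 / p))⁻¹ * t) := by
      apply h.mono_abs
      rw [abs_of_pos (by positivity), abs_of_pos (by positivity)]
      gcongr
    push_cast at key
    have h3 : (n : ℝ) * b * φ (l * t) ≤ 1 := le_trans (by gcongr) key
    have h4 : (1 : ℝ) ≤ (2 * n * (2 * C * l) ^ p) * (2 * b * φ t) := by nlinarith
    have h5 : (n * b : ℝ) * φ (l * t) ≤ (n * b) * (4 * (2 * C * l) ^ p * φ t) := by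
      linarith
    exact le_of_mul_le_mul_left h5 (by positivity)
  · have h1 : φ (l * t) ≤ φ t := by
      apply h.mono_abs
      rw [abs_of_pos (by positivity), abs_of_pos ht]
      nlinarith
    nlinarith

lemma IsOrliczFunction.delta_two_near_zero {φ : ℝ → ℝ} (h : IsOrliczFunction φ) {p : ℝ}
    (hp : 1 < p) (hT : HasType (orliczSpace φ) (orliczNorm φ) p) :
    ∃ δ > 0, ∃ D > 0, ∀ t : ℝ, 0 < t → φ t ≤ δ → φ (2 * t) ≤ D * φ t := by
  have hp0 : 0 < p := by linarith
  obtain ⟨C, hC, hT⟩ := hT.exists_sign hp0 luxemburg_nonneg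
  have hC0 : 0 < C := by linarith
  -- `m` is so large that the vectors `±x₁ ± ... ± xₘ` are too long for type `p`
  obtain ⟨m, hm0, hm⟩ : ∃ m : ℕ, 0 < m ∧ 4 * C ≤ (m : ℝ) ^ (1 - 1 / p) := by
    have hpos : 0 < 1 - 1 / p := by
      rw [sub_pos, div_lt_one hp0]; exact hp
    have := ((tendsto_rpow_atTop hpos).comp tendsto_natCast_atTop_atTop).eventually_ge_atTop (4 * C)
    obtain ⟨m, h1, h2⟩ := ((eventually_gt_atTop 0).and this).exists
    exact ⟨m, h1, h2⟩
  have hm' : (0 : ℝ) < m := by exact_mod_cast hm0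
  refine ⟨(2 ^ m)⁻¹, by positivity, 2 * 2 ^ m, by positivity, fun t ht htd => ?_⟩
  have hφt := h.pos t ht
  have h2m : (0 : ℝ) < 2 ^ m := by positivity
  have hu1 : 2 ^ m * φ t ≤ 1 := by
    calc 2 ^ m * φ t ≤ 2 ^ m * (2 ^ m)⁻¹ := by gcongr
      _ = 1 := mul_inv_cancel₀ h2m.ne'
  obtain ⟨b, hb, hb1, hb2⟩ := exists_nat_mul_near_one (by positivity) hu1
  have hb' : (0 : ℝ) < b := by exact_mod_cast hb
  have key := h.rademacher_of_hasType hC hT hm0 hb (t := t) (by push_cast; linarith)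
  have h1 : φ (2 * t) ≤ φ ((2 * C * (m : ℝ) ^ (1 / p))⁻¹ * (m * t)) := by
    apply h.mono_abs
    rw [abs_of_pos (by positivity), abs_of_pos (by positivity), ← mul_assoc]
    gcongr
    rw [inv_mul_eq_div, le_div_iff₀ (by positivity)]
    have e : (m : ℝ) = (m : ℝ) ^ (1 - 1 / p) * (m : ℝ) ^ (1 / p) := by
      rw [← Real.rpow_add hm']; simp
    calc 2 * (2 * C * (m : ℝ) ^ (1 / p)) = 4 * C * (m : ℝ) ^ (1 / p) := by ring
      _ ≤ (m : ℝ) ^ (1 - 1 / p) * (m : ℝ) ^ (1 / p) := by gcongr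
      _ = m := e.symm
  have h2 : (b : ℝ) * φ (2 * t) ≤ b * (2 * 2 ^ m * φ t) :=
    calc (b : ℝ) * φ (2 * t) ≤ 1 := le_trans (by gcongr) key
      _ ≤ _ := by linarith
  exact le_of_mul_le_mul_left h2 hb'

/-! ### Regular extension of an Orlicz function beyond the unit interval -/

/-- The even function that agrees with `φ` on `[0, 1]` and equals
`φ(1) + c (t - 1) + t ^ p - 1` with `c = φ(2) - φ(1)` for `t ≥ 1`. The slope `c` is at least
every slope of `φ` on `[0, 1]`, so that convexity is preserved. -/
noncomputable def regularExtension (φ : ℝ → ℝ) (p : ℝ) (x : ℝ) : ℝ :=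
  φ (min |x| 1) + (φ 2 - φ 1) * (|x| - min |x| 1) + ((max |x| 1) ^ p - 1)

section Extension

variable {φ : ℝ → ℝ} {p : ℝ}

lemma regularExtension_of_le {x : ℝ} (hx : |x| ≤ 1) : regularExtension φ p x = φ |x| := by
  simp [regularExtension, min_eq_left hx, max_eq_right hx]

lemma regularExtension_of_ge {x : ℝ} (hx : 1 ≤ |x|) :
    regularExtension φ p x = φ 1 + (φ 2 - φ 1) * (|x| - 1) + (|x| ^ p - 1) := by
  simp [regularExtension, min_eq_right hx, max_eq_left hx]

lemma IsOrliczFunction.sub_le_slope_mul (h : IsOrliczFunction φ) {s t : ℝ} (hs : 0 ≤ s)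
    (hst : s ≤ t) (ht : t ≤ 1) : φ t - φ s ≤ (φ 2 - φ 1) * (t - s) := by
  rcases hst.eq_or_lt with rfl | hlt
  · simp
  have key : (φ t - φ s) / (t - s) ≤ (φ 2 - φ 1) / (2 - 1) := by
    rcases ht.eq_or_lt with rfl | ht
    · exact h.convexOn.slope_mono_adjacent hs (show (0 : ℝ) ≤ 2 by norm_num) hlt (by norm_num)
    · exact (h.convexOn.slope_mono_adjacent hs (show (0 : ℝ) ≤ 1 by norm_num) hlt ht).trans
        (h.convexOn.slope_mono_adjacent (hs.trans hst) (show (0 : ℝ) ≤ 2 by norm_num) ht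
          (by norm_num))
  rw [div_le_iff₀ (by linarith)] at key
  linarith

/-- The extension by an affine function of large slope is convex, being an infimal convolution. -/
lemma IsOrliczFunction.convexOn_affine_extension (h : IsOrliczFunction φ) :
    ConvexOn ℝ (Ici 0) fun t => φ (min t 1) + (φ 2 - φ 1) * (t - min t 1) := by
  refine ⟨convex_Ici 0, fun x hx y hy a b ha hb hab => ?_⟩
  simp only [smul_eq_mul, mem_Ici] at *
  set s := a * min x 1 + b * min y 1 with hs
  have hx0 : 0 ≤ min x 1 := le_min hx zero_le_one
  have hy0 : 0 ≤ min y 1 := le_min hy zero_le_one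
  have hs0 : 0 ≤ s := by positivity
  have hsz : s ≤ min (a * x + b * y) 1 := by
    refine le_min ?_ ?_
    · have := mul_le_mul_of_nonneg_left (min_le_left x 1) ha
      have := mul_le_mul_of_nonneg_left (min_le_left y 1) hb
      linarith
    · have := mul_le_mul_of_nonneg_left (min_le_right x 1) ha
      have := mul_le_mul_of_nonneg_left (min_le_right y 1) hb
      linarith
  have h1 := h.sub_le_slope_mul hs0 hsz (min_le_right _ _)
  have h2 := h.convexOn.2 hx0 hy0 ha hb hab
  simp only [smul_eq_mul] at h2
  rw [← hs] at h2
  linear_combination h1 + h2 + (φ 2 - φ 1) * hs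

lemma IsOrliczFunction.slope_nonneg (h : IsOrliczFunction φ) : 0 ≤ φ 2 - φ 1 :=
  sub_nonneg.2 (h.mono_abs (by norm_num))

lemma IsOrliczFunction.regularExtension (h : IsOrliczFunction φ) (hp : 1 < p) :
    IsOrliczFunction (regularExtension φ p) := by
  have hc := h.slope_nonneg
  have hmono : MonotoneOn (TwistedSum.regularExtension φ p) (Ici 0) := by
    intro x hx y hy hxy
    simp only [mem_Ici] at hx hy
    have hp0 : 0 ≤ p := by linarith
    have h1 : (max |x| 1) ^ p ≤ (max |y| 1) ^ p := by
      rw [abs_of_nonneg hx, abs_of_nonneg hy]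
      exact Real.rpow_le_rpow (by positivity) (max_le_max_right 1 hxy) hp0
    have h2 : φ (min |x| 1) ≤ φ (min |y| 1) := by
      rw [abs_of_nonneg hx, abs_of_nonneg hy]
      exact h.map_le_map (le_min hx zero_le_one) (min_le_min_right 1 hxy)
    have h3 : |x| - min |x| 1 ≤ |y| - min |y| 1 := by
      rw [abs_of_nonneg hx, abs_of_nonneg hy]
      rcases le_total x 1 with h4 | h4 <;> rcases le_total y 1 with h5 | h5 <;>
        simp [h4, h5] <;> linarith
    have h4 := mul_le_mul_of_nonneg_left h3 hc
    unfold TwistedSum.regularExtension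
    linarith
  refine ⟨?_, hmono, ?_, ?_, ?_, ?_⟩
  · have h1 : ConvexOn ℝ (Ici (0 : ℝ)) fun t : ℝ => (max t 1) ^ p := by
      have h2 : ConvexOn ℝ (Ici (0 : ℝ)) fun t : ℝ => max t 1 :=
        (convexOn_id (convex_Ici 0)).sup (convexOn_const 1 (convex_Ici 0))
      refine ⟨convex_Ici 0, fun x hx y hy a b ha hb hab => ?_⟩
      have h3 := h2.2 hx hy ha hb hab
      have h4 := (convexOn_rpow hp.le).2 (x := max x 1) (y := max y 1)
        (by simp) (by simp) ha hb hab
      exact (Real.rpow_le_rpow (by positivity) h3 (by linarith)).trans h4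
    have h5 := (h.convexOn_affine_extension.add h1).add
      (convexOn_const (-1 : ℝ) (convex_Ici (0 : ℝ)))
    refine h5.congr fun x hx => ?_
    rw [mem_Ici] at hx
    simp only [TwistedSum.regularExtension, Pi.add_apply, abs_of_nonneg hx]
    ring
  · rw [regularExtension_of_le (by simp), abs_zero, h.map_zero]
  · have h1 : Tendsto (fun x : ℝ => x ^ p - 1) atTop atTop :=
      (tendsto_atTop_add_const_right _ (-1) (tendsto_rpow_atTop (by linarith)))
    refine tendsto_atTop_mono' _ ?_ h1
    filter_upwards [eventually_ge_atTop (1 : ℝ)] with x hx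
    have hx' : |x| = x := abs_of_nonneg (by linarith)
    rw [regularExtension_of_ge (by rwa [hx']), hx']
    have := h.nonneg 1
    have := mul_nonneg hc (sub_nonneg.2 hx)
    linarith
  · intro x hx
    have h1 : 0 < φ (min x 1) := h.pos _ (lt_min hx one_pos)
    have h2 : TwistedSum.regularExtension φ p (min x 1) = φ (min x 1) := by
      rw [regularExtension_of_le, abs_of_pos (lt_min hx one_pos)]
      rw [abs_of_pos (lt_min hx one_pos)]; exact min_le_right _ _
    have h3 : (0 : ℝ) ≤ min x 1 := le_min hx.le zero_le_one
    rw [← h2] at h1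
    exact h1.trans_le (hmono h3 hx.le (min_le_left _ _))
  · intro x
    simp [TwistedSum.regularExtension]

/-- Beyond `1/2` the extension is comparable with the power `t ^ p`. -/
lemma IsOrliczFunction.regularExtension_comparable (h : IsOrliczFunction φ) (hp : 1 < p) :
    ∃ c > 0, ∃ C > 0, ∀ t : ℝ, 1 / 2 ≤ t →
      c * t ^ p ≤ TwistedSum.regularExtension φ p t ∧
      TwistedSum.regularExtension φ p t ≤ C * t ^ p := by
  have hψ := h.regularExtension hp
  have hc := h.slope_nonneg
  have hp0 : 0 < p := by linarith
  have h1 := h.pos 1 one_pos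
  have hhalf := h.pos (1 / 2) (by norm_num)
  have hhp : (0 : ℝ) < (1 / 2 : ℝ) ^ p := by positivity
  refine ⟨min (φ (1 / 2)) (min (φ 1) 1), by positivity,
    φ 1 / (1 / 2) ^ p + φ 1 + (φ 2 - φ 1) + 1, by positivity, fun t ht => ?_⟩
  have ht0 : 0 < t := by linarith
  have habs : |t| = t := abs_of_pos ht0
  have htp : 0 < t ^ p := by positivity
  rcases le_total t 1 with ht1 | ht1
  · rw [regularExtension_of_le (by rwa [habs]), habs]
    have h2 : φ (1 / 2) ≤ φ t := h.map_le_map (by norm_num : (0 : ℝ) ≤ 1 / 2) ht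
    have h3 : φ t ≤ φ 1 := h.map_le_map ht0.le ht1
    constructor
    · calc _ ≤ φ (1 / 2) * 1 := by
            gcongr
            · exact min_le_left _ _
            · exact Real.rpow_le_one ht0.le ht1 hp0.le
        _ ≤ φ t := by linarith
    · have h4 : (1 / 2 : ℝ) ^ p ≤ t ^ p := Real.rpow_le_rpow (by norm_num) ht hp0.le
      have h5 : φ 1 ≤ φ 1 / (1 / 2) ^ p * t ^ p := by
        rw [div_mul_eq_mul_div, le_div_iff₀ hhp]
        gcongr
      have : 0 ≤ (φ 1 + (φ 2 - φ 1) + 1) * t ^ p := by positivity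
      linarith
  · rw [regularExtension_of_ge (by rwa [habs]), habs]
    have h2 : t ≤ t ^ p := by
      simpa using Real.rpow_le_rpow_of_exponent_le ht1 hp.le
    constructor
    · have h3 : min (φ (1 / 2)) (min (φ 1) 1) * (t ^ p - 1) ≤ 1 * (t ^ p - 1) := by
        refine mul_le_mul_of_nonneg_right ?_ (by linarith)
        exact (min_le_right _ _).trans (min_le_right _ _)
      have h4 : min (φ (1 / 2)) (min (φ 1) 1) ≤ φ 1 := (min_le_right _ _).trans (min_le_left _ _)
      have h5 := mul_nonneg hc (sub_nonneg.2 ht1)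
      linarith
    · have h3 : 0 ≤ φ 1 / (1 / 2) ^ p * t ^ p := by positivity
      have h4 := mul_le_mul_of_nonneg_left h2 hc
      have h5 : φ 1 * 1 ≤ φ 1 * t ^ p := by gcongr; linarith
      nlinarith

/-- The bound `φ(l t) ≤ M l ^ p φ(t)` near zero extends to the unit interval. -/
lemma IsOrliczFunction.power_bound_unit (h : IsOrliczFunction φ) (hp : 1 < p)
    (hφ : ∃ M > 0, ∀ l t : ℝ, 0 < l → 0 < t → φ t ≤ 1 → l ≤ 1 → φ (l * t) ≤ M * l ^ p * φ t) :
    ∃ M > 0, ∀ l t : ℝ, 0 < l → l ≤ 1 → 0 < t → t ≤ 1 → φ (l * t) ≤ M * l ^ p * φ t := by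
  obtain ⟨M, hM, hφ⟩ := hφ
  obtain ⟨r, hr0, hr⟩ := h.exists_eq zero_le_one
  have hrpos : 0 < r := by
    rcases hr0.eq_or_lt with rfl | h1
    · rw [h.map_zero] at hr; norm_num at hr
    · exact h1
  refine ⟨max M 1 / r ^ p + M, by positivity, fun l t hl hl1 ht ht1 => ?_⟩
  have hφt := h.pos t ht
  have hlp : 0 < l ^ p := by positivity
  rcases le_total t r with htr | htr
  · have h1 : φ t ≤ 1 := hr ▸ h.map_le_map ht.le htr
    have h2 : 0 ≤ max M 1 / r ^ p * (l ^ p * φ t) := by positivity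
    have h3 := hφ l t hl ht h1 hl1
    linarith
  · have hmain : φ (l * t) ≤ max M 1 / r ^ p * l ^ p * φ t := by
      have hφr : φ r ≤ φ t := h.map_le_map hr0 htr
      rcases le_total l r with hlr | hlr
      · have h1 := hφ (l / r) r (by positivity) hrpos hr.le ((div_le_one hrpos).2 hlr)
        rw [div_mul_cancel₀ _ hrpos.ne', Real.div_rpow hl.le hr0] at h1
        calc φ (l * t) ≤ φ l := h.map_le_map (by positivity) (mul_le_of_le_one_right hl.le ht1)
          _ ≤ M * (l ^ p / r ^ p) * φ r := h1
          _ ≤ max M 1 * (l ^ p / r ^ p) * φ t := by gcongr; exact le_max_left _ _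
          _ = _ := by ring
      · have h1 : r ^ p ≤ l ^ p := Real.rpow_le_rpow hr0 hlr (by linarith)
        calc φ (l * t) ≤ φ t := h.map_le_map (by positivity) (mul_le_of_le_one_left ht.le hl1)
          _ = 1 * φ t := (one_mul _).symm
          _ ≤ max M 1 / r ^ p * l ^ p * φ t := by
            gcongr
            rw [div_mul_eq_mul_div, le_div_iff₀ (by positivity)]
            exact mul_le_mul (le_max_right _ _) h1 (by positivity) (by positivity)
    have h2 : 0 ≤ M * (l ^ p * φ t) := by positivity
    linarith

lemma IsOrliczFunction.delta_two_unit (h : IsOrliczFunction φ)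
    (hφ : ∃ δ > 0, ∃ D > 0, ∀ t : ℝ, 0 < t → φ t ≤ δ → φ (2 * t) ≤ D * φ t) :
    ∃ D > 0, ∀ t : ℝ, 0 < t → t ≤ 1 / 2 → φ (2 * t) ≤ D * φ t := by
  obtain ⟨δ, hδ, D, hD, hφ⟩ := hφ
  have h1 := h.pos 1 one_pos
  refine ⟨D + φ 1 / δ, by positivity, fun t ht ht1 => ?_⟩
  have hφt := h.pos t ht
  have h2 : 0 ≤ D * φ t := by positivity
  have h3 : 0 ≤ φ 1 / δ * φ t := by positivity
  rcases le_total (φ t) δ with h4 | h4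
  · linarith [hφ t ht h4]
  · have h5 : φ (2 * t) ≤ φ 1 := h.map_le_map (by positivity) (by linarith)
    have h6 : φ 1 ≤ φ 1 / δ * φ t := by
      rw [div_mul_eq_mul_div, le_div_iff₀ hδ]
      gcongr
    linarith

/-- An Orlicz function with non-trivial type can be modified away from `[0, 1]` so as to satisfy
the growth conditions globally. -/
lemma IsOrliczFunction.exists_regular (h : IsOrliczFunction φ)
    (hT : HasNontrivialType (orliczSpace φ) (orliczNorm φ)) :
    ∃ ψ : ℝ → ℝ, IsOrliczFunction ψ ∧ EqOn ψ φ (Icc 0 1) ∧ PowerBound ψ ∧ DeltaTwo ψ := by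
  obtain ⟨p, hp, -, hT⟩ := hT
  have hp0 : 0 < p := by linarith
  have hψ := h.regularExtension hp
  have heq : EqOn (TwistedSum.regularExtension φ p) φ (Icc 0 1) := fun x hx => by
    rw [regularExtension_of_le] <;> rw [abs_of_nonneg hx.1]
    exact hx.2
  obtain ⟨c, hc, C, hC, hcC⟩ := h.regularExtension_comparable hp
  have h1 := h.pos 1 one_pos
  refine ⟨_, hψ, heq, ?_, ?_⟩
  · obtain ⟨M, hM, hMφ⟩ := h.power_bound_unit hp (h.power_bound_near_zero hp hT)
    refine ⟨p, hp, M + M * φ 1 / c + C / c, by positivity, fun l s hl hl1 hs => ?_⟩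
    have hψs := hψ.pos s hs
    have hls : 0 < l * s := by positivity
    have hlp : 0 < l ^ p := by positivity
    have hA : 0 ≤ M * (l ^ p * TwistedSum.regularExtension φ p s) := by positivity
    have hB : 0 ≤ M * φ 1 / c * (l ^ p * TwistedSum.regularExtension φ p s) := by positivity
    have hD : 0 ≤ C / c * (l ^ p * TwistedSum.regularExtension φ p s) := by positivity
    rcases le_total s 1 with hs1 | hs1
    · have e1 := heq (x := s) ⟨hs.le, hs1⟩
      have e2 := heq (x := l * s) ⟨hls.le, by nlinarith⟩
      have := hMφ l s hl hl1 hs hs1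
      rw [← e1, ← e2] at this
      linarith
    · have hlow := (hcC s (by linarith)).1
      have hsp : 0 < s ^ p := by positivity
      rcases le_total (l * s) 1 with hls1 | hls1
      · have e2 := heq (x := l * s) ⟨hls.le, hls1⟩
        have h2 := hMφ (l * s) 1 hls hls1 one_pos le_rfl
        rw [mul_one, ← e2, Real.mul_rpow hl.le hs.le] at h2
        have h3 : M * (l ^ p * s ^ p) * φ 1 ≤
            M * φ 1 / c * (l ^ p * TwistedSum.regularExtension φ p s) :=
          calc M * (l ^ p * s ^ p) * φ 1 = M * φ 1 / c * (l ^ p * (c * s ^ p)) := by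
                field_simp
            _ ≤ _ := by gcongr
        linarith
      · have h2 := (hcC (l * s) (by linarith)).2
        rw [Real.mul_rpow hl.le hs.le] at h2
        have h3 : C * (l ^ p * s ^ p) ≤ C / c * (l ^ p * TwistedSum.regularExtension φ p s) :=
          calc C * (l ^ p * s ^ p) = C / c * (l ^ p * (c * s ^ p)) := by field_simp
            _ ≤ _ := by gcongr
        linarith
  · obtain ⟨D, hD, hDφ⟩ := h.delta_two_unit (h.delta_two_near_zero hp hT)
    refine ⟨D + C * 2 ^ p / c, by positivity, fun s hs => ?_⟩
    rcases hs.eq_or_lt with rfl | hs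
    · simp [hψ.map_zero]
    have hψs := hψ.pos s hs
    have hA : 0 ≤ D * TwistedSum.regularExtension φ p s := by positivity
    have hB : 0 ≤ C * 2 ^ p / c * TwistedSum.regularExtension φ p s := by positivity
    rcases le_total s (1 / 2) with hs1 | hs1
    · have e1 := heq (x := s) ⟨hs.le, by linarith⟩
      have e2 := heq (x := 2 * s) ⟨by linarith, by linarith⟩
      have := hDφ s hs hs1
      rw [← e1, ← e2] at this
      linarith
    · have h2 := (hcC (2 * s) (by linarith)).2
      rw [Real.mul_rpow (by norm_num) hs.le] at h2
      have h3 : C * (2 ^ p * s ^ p) ≤ C * 2 ^ p / c * TwistedSum.regularExtension φ p s :=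
        calc C * (2 ^ p * s ^ p) = C * 2 ^ p / c * (c * s ^ p) := by field_simp
          _ ≤ _ := mul_le_mul_of_nonneg_left (hcC s hs1).1 (by positivity)
      linarith

end Extension

/-! ### The convex envelope -/

section Envelope

variable {E : Type*} [AddCommGroup E] [Module ℝ E] {Φ : E → ℝ}

lemma bddBelow_convexEnvelope (h : ∀ v, 0 ≤ Φ v) (x : E) :
    BddBelow {s | ∃ (m : ℕ) (α : Fin m → ℝ) (t : Fin m → E), (∀ i, 0 ≤ α i) ∧ ∑ i, α i = 1 ∧
      ∑ i, α i • t i = x ∧ ∑ i, α i * Φ (t i) = s} := by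
  refine ⟨0, ?_⟩
  rintro _ ⟨m, α, t, hα, -, -, rfl⟩
  exact Finset.sum_nonneg fun i _ => mul_nonneg (hα i) (h _)

lemma nonempty_convexEnvelope (Φ : E → ℝ) (x : E) :
    {s | ∃ (m : ℕ) (α : Fin m → ℝ) (t : Fin m → E), (∀ i, 0 ≤ α i) ∧ ∑ i, α i = 1 ∧
      ∑ i, α i • t i = x ∧ ∑ i, α i * Φ (t i) = s}.Nonempty :=
  ⟨Φ x, 1, fun _ => 1, fun _ => x, by simp, by simp, by simp, by simp⟩

lemma convexEnvelope_le_sum (h : ∀ v, 0 ≤ Φ v) {m : ℕ} {α : Fin m → ℝ} {t : Fin m → E}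
    (hα : ∀ i, 0 ≤ α i) (hα1 : ∑ i, α i = 1) :
    convexEnvelope Φ (∑ i, α i • t i) ≤ ∑ i, α i * Φ (t i) :=
  csInf_le (bddBelow_convexEnvelope h _) ⟨m, α, t, hα, hα1, rfl, rfl⟩

lemma convexEnvelope_le (h : ∀ v, 0 ≤ Φ v) (x : E) : convexEnvelope Φ x ≤ Φ x := by
  simpa using convexEnvelope_le_sum h (m := 1) (α := fun _ => 1) (t := fun _ => x)
    (by simp) (by simp)

lemma convexEnvelope_nonneg (h : ∀ v, 0 ≤ Φ v) (x : E) : 0 ≤ convexEnvelope Φ x :=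
  Real.sInf_nonneg (by
    rintro _ ⟨m, α, t, hα, -, -, rfl⟩
    exact Finset.sum_nonneg fun i _ => mul_nonneg (hα i) (h _))

lemma convexOn_convexEnvelope (h : ∀ v, 0 ≤ Φ v) : ConvexOn ℝ univ (convexEnvelope Φ) := by
  refine ⟨convex_univ, fun x _ y _ a b ha hb hab => ?_⟩
  refine le_of_forall_pos_le_add fun ε hε => ?_
  obtain ⟨_, ⟨m, α, t, hα, hα1, rfl, rfl⟩, h1⟩ :=
    exists_lt_of_csInf_lt (nonempty_convexEnvelope Φ x) (lt_add_of_pos_right _ hε)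
  obtain ⟨_, ⟨n, β, u, hβ, hβ1, rfl, rfl⟩, h2⟩ :=
    exists_lt_of_csInf_lt (nonempty_convexEnvelope Φ y) (lt_add_of_pos_right _ hε)
  have key := convexEnvelope_le_sum h
    (α := Fin.append (fun i => a * α i) fun i => b * β i) (t := Fin.append t u)
    (fun i => by
      refine Fin.addCases (fun j => ?_) (fun j => ?_) i
      · simpa using mul_nonneg ha (hα j)
      · simpa using mul_nonneg hb (hβ j))
    (by simp [Fin.sum_univ_add, ← Finset.mul_sum, hα1, hβ1, hab])
  simp only [Fin.sum_univ_add, Fin.append_left, Fin.append_right, mul_smul, mul_assoc,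
    ← Finset.smul_sum, ← Finset.mul_sum] at key
  simp only [smul_eq_mul]
  change _ < convexEnvelope Φ _ + ε at h1
  change _ < convexEnvelope Φ _ + ε at h2
  have h3 := mul_le_mul_of_nonneg_left h1.le ha
  have h4 := mul_le_mul_of_nonneg_left h2.le hb
  calc _ ≤ _ := key
    _ ≤ a * (convexEnvelope Φ (∑ i, α i • t i) + ε) +
        b * (convexEnvelope Φ (∑ i, β i • u i) + ε) := add_le_add h3 h4
    _ = _ := by linear_combination ε * hab

lemma convexEnvelope_neg (he : ∀ v, Φ (-v) = Φ v) (x : E) :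
    convexEnvelope Φ (-x) = convexEnvelope Φ x := by
  unfold convexEnvelope
  congr 1
  ext s
  constructor <;> rintro ⟨m, α, t, hα, hα1, hx, hs⟩ <;>
    exact ⟨m, α, fun i => -t i, hα, hα1, by simp [hx], by simpa [he] using hs⟩

end Envelope

/-! ### Quasi-convexity of the function `Φ` -/

lemma abs_mul_sub_mul_le {θ : ℝ → ℝ} {K : ℝ≥0} (hθ : LipschitzWith K θ) (y u v : ℝ) :
    |y * θ u - y * θ v| ≤ K * (|y| * |u - v|) := by
  have := hθ.dist_le_mul u v
  rw [Real.dist_eq, Real.dist_eq] at this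
  rw [← mul_sub, abs_mul]
  calc |y| * |θ u - θ v| ≤ |y| * (K * |u - v|) := by gcongr
    _ = _ := by ring

/-- The bound needed to replace the argument `log (1 / |y|)` of `θ` by the constant
`log (1 / A)`. -/
lemma abs_mul_log_sub_mul_le {θ : ℝ → ℝ} {K : ℝ≥0} (hθ : LipschitzWith K θ) {A : ℝ} (hA : 0 < A)
    (y : ℝ) : |y * θ (Real.log (1 / |y|)) - y * θ (Real.log (1 / A))| ≤
      K * (|y| * |Real.log (|y| / A)|) := by
  rcases eq_or_ne y 0 with rfl | hy
  · simp
  refine (abs_mul_sub_mul_le hθ _ _ _).trans (le_of_eq ?_)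
  rw [one_div, one_div, Real.log_inv, Real.log_inv, Real.log_div (abs_pos.2 hy).ne' hA.ne',
    neg_sub_neg, abs_sub_comm]

/-- The bound needed to rescale the argument of `θ`. -/
lemma abs_mul_log_div_sub_le {θ : ℝ → ℝ} {K : ℝ≥0} (hθ : LipschitzWith K θ) {a b : ℝ}
    (ha : 0 < a) (hb : 0 < b) (y : ℝ) :
    |y * θ (Real.log (a / |y|)) - y * θ (Real.log (b / |y|))| ≤
      K * (|y| * |Real.log (a / b)|) := by
  rcases eq_or_ne y 0 with rfl | hy
  · simp
  have hy' := (abs_pos.2 hy).ne'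
  refine (abs_mul_sub_mul_le hθ _ _ _).trans (le_of_eq ?_)
  rw [Real.log_div ha.ne' hy', Real.log_div hb.ne' hy', Real.log_div ha.ne' hb.ne',
    sub_sub_sub_cancel_right]

lemma abs_mul_abs_log_div_le {A w : ℝ} (hA : 0 < A) (hw : |w| ≤ A) :
    |w| * |Real.log (|w| / A)| ≤ A := by
  rcases eq_or_ne w 0 with rfl | hw0
  · simp [hA.le]
  have := Real.abs_log_mul_self_lt (|w| / A) (div_pos (abs_pos.2 hw0) hA) ((div_le_one hA).2 hw)
  rw [abs_mul, abs_div, abs_abs, abs_of_pos hA] at this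
  calc |w| * |Real.log (|w| / A)| = A * (|Real.log (|w| / A)| * (|w| / A)) := by
        field_simp
    _ ≤ A * 1 := by gcongr
    _ = A := mul_one A

/-- A truncated entropy estimate: this is where the power bound enters. -/
lemma IsOrliczFunction.abs_mul_abs_log_div_le {ψ : ℝ → ℝ} (h : IsOrliczFunction ψ) {p M : ℝ}
    (hp : 1 < p) (hM : 0 < M)
    (hψ : ∀ l s : ℝ, 0 < l → l ≤ 1 → 0 < s → ψ (l * s) ≤ M * l ^ p * ψ s)
    {A : ℝ} (hA : 0 < A) (w : ℝ) :
    |w| * |Real.log (|w| / A)| ≤ A * (1 + M / (p - 1) * (ψ w / ψ A)) := by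
  have hψA := h.pos A hA
  have hψw := h.nonneg w
  have hp1 : 0 < p - 1 := by linarith
  rcases le_or_gt |w| A with hw | hw
  · refine (TwistedSum.abs_mul_abs_log_div_le hA hw).trans (le_mul_of_one_le_right hA.le ?_)
    have : 0 ≤ M / (p - 1) * (ψ w / ψ A) := by positivity
    linarith
  · have hw0 : 0 < |w| := hA.trans hw
    have hr : 0 < |w| / A := by positivity
    have hr1 : 1 ≤ |w| / A := (one_le_div hA).2 hw.le
    rw [abs_of_nonneg (Real.log_nonneg hr1)]
    have h1 := hψ (A / |w|) |w| (by positivity) ((div_le_one hw0).2 hw.le) hw0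
    rw [div_mul_cancel₀ _ hw0.ne', h.map_abs, ← inv_div, Real.inv_rpow hr.le] at h1
    have hrp : 0 < (|w| / A) ^ p := by positivity
    have h2 : (|w| / A) ^ p ≤ M * (ψ w / ψ A) := by
      rw [mul_div_assoc', le_div_iff₀ hψA]
      calc (|w| / A) ^ p * ψ A ≤ (|w| / A) ^ p * (M * ((|w| / A) ^ p)⁻¹ * ψ w) := by gcongr
        _ = M * ψ w := by field_simp
    have h3 := Real.log_le_rpow_div hr.le hp1
    calc |w| * Real.log (|w| / A) ≤ |w| * ((|w| / A) ^ (p - 1) / (p - 1)) := by gcongr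
      _ = A * ((|w| / A) ^ p / (p - 1)) := by
        rw [show |w| = A * (|w| / A) by field_simp, mul_div_cancel_left₀ _ hA.ne',
          Real.rpow_sub_one hr.ne']
        field_simp
      _ ≤ A * (M * (ψ w / ψ A) / (p - 1)) := by gcongr
      _ ≤ A * (1 + M / (p - 1) * (ψ w / ψ A)) := by
        gcongr
        rw [mul_div_right_comm]
        linarith

section Function

variable {ψ θ : ℝ → ℝ} {K : ℝ≥0}

lemma kpFunction_nonneg (h : IsOrliczFunction ψ) (θ : ℝ → ℝ) (v : ℝ × ℝ) :
    0 ≤ kpFunction ψ θ v := add_nonneg (h.nonneg _) (h.nonneg _)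

lemma kpFunction_neg (h : IsOrliczFunction ψ) (θ : ℝ → ℝ) (v : ℝ × ℝ) :
    kpFunction ψ θ (-v) = kpFunction ψ θ v := by
  simp only [kpFunction, Prod.fst_neg, Prod.snd_neg, abs_neg]
  rw [h.even, ← h.even (v.1 - _)]
  ring_nf

lemma kpFunction_zero (h : IsOrliczFunction ψ) (θ : ℝ → ℝ) : kpFunction ψ θ 0 = 0 := by
  simp [kpFunction, h.map_zero]

/-- For a convex combination with weights `α` of numbers `y i`, the defect of linearity of
`y ↦ y θ(log (1 / |y|))` is at most a multiple of the number `A ≥ 0` for which `ψ A` is the average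
of the `ψ (y i)`. The point is to compare every `θ(log (1 / |y|))` with `θ(log (1 / A))`. -/
lemma IsOrliczFunction.exists_defect_le (h : IsOrliczFunction ψ) (hP : PowerBound ψ)
    (hθ : LipschitzWith K θ) :
    ∃ c, ∀ (m : ℕ) (α y : Fin m → ℝ), (∀ i, 0 ≤ α i) → ∑ i, α i = 1 →
      ∀ A, 0 ≤ A → ψ A = ∑ i, α i * ψ (y i) →
      |∑ i, α i * (y i * θ (Real.log (1 / |y i|))) -
        (∑ i, α i * y i) * θ (Real.log (1 / |∑ i, α i * y i|))| ≤ c * A := by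
  obtain ⟨p, hp, M, hM, hψ⟩ := hP
  refine ⟨K * (2 * (1 + M / (p - 1))), fun m α y hα hα1 A hA hAB => ?_⟩
  have hp1 : 0 < p - 1 := by linarith
  rcases hA.eq_or_lt with rfl | hA
  -- If `A = 0`, then `α i * y i = 0` for all `i`, and both terms vanish.
  · rw [h.map_zero, eq_comm, Finset.sum_eq_zero_iff_of_nonneg
      fun i _ => mul_nonneg (hα i) (h.nonneg _)] at hAB
    have hz : ∀ i, α i = 0 ∨ y i = 0 := fun i => by
      simpa [h.eq_zero_iff] using hAB i (Finset.mem_univ i)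
    have h1 : ∀ i, α i * (y i * θ (Real.log (1 / |y i|))) = 0 := fun i => by
      rcases hz i with h | h <;> simp [h]
    have h2 : ∀ i, α i * y i = 0 := fun i => by
      rcases hz i with h | h <;> simp [h]
    rw [Finset.sum_congr rfl fun i _ => h1 i, Finset.sum_congr rfl fun i _ => h2 i]
    simp
  have hψA := h.pos A hA
  set τ := θ (Real.log (1 / A)) with hτ
  have hlog : ∀ w : ℝ, |w * θ (Real.log (1 / |w|)) - w * τ| ≤
      K * (A * (1 + M / (p - 1) * (ψ w / ψ A))) := fun w =>
    (abs_mul_log_sub_mul_le hθ hA w).trans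
      (mul_le_mul_of_nonneg_left (h.abs_mul_abs_log_div_le hp hM hψ hA w) K.coe_nonneg)
  set ybar := ∑ i, α i * y i with hy
  have hJ : ψ ybar ≤ ψ A := by
    rw [hAB]
    simpa using h.convexOn_univ.map_sum_le (t := Finset.univ) (w := α) (p := y)
      (fun i _ => hα i) hα1 (fun i _ => mem_univ _)
  have h1 : |∑ i, α i * (y i * θ (Real.log (1 / |y i|)) - y i * τ)| ≤
      K * (A * (1 + M / (p - 1))) := by
    calc _ ≤ ∑ i, |α i * (y i * θ (Real.log (1 / |y i|)) - y i * τ)| :=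
          Finset.abs_sum_le_sum_abs _ _
      _ ≤ ∑ i, α i * (K * (A * (1 + M / (p - 1) * (ψ (y i) / ψ A)))) := by
          refine Finset.sum_le_sum fun i _ => ?_
          rw [abs_mul, abs_of_nonneg (hα i)]
          exact mul_le_mul_of_nonneg_left (hlog _) (hα i)
      _ = K * A * (∑ i, α i + M / (p - 1) / ψ A * ∑ i, α i * ψ (y i)) := by
          rw [Finset.mul_sum, ← Finset.sum_add_distrib, Finset.mul_sum]
          refine Finset.sum_congr rfl fun i _ => ?_
          ring
      _ = K * (A * (1 + M / (p - 1))) := by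
          rw [hα1, ← hAB]
          field_simp
  have h2 : |ybar * θ (Real.log (1 / |ybar|)) - ybar * τ| ≤ K * (A * (1 + M / (p - 1))) := by
    refine (hlog ybar).trans ?_
    have h3 : ψ ybar / ψ A ≤ 1 := (div_le_one hψA).2 hJ
    have h4 : M / (p - 1) * (ψ ybar / ψ A) ≤ M / (p - 1) :=
      mul_le_of_le_one_right (by positivity) h3
    gcongr
  have e : ∑ i, α i * (y i * θ (Real.log (1 / |y i|))) - ybar * θ (Real.log (1 / |ybar|)) =
      ∑ i, α i * (y i * θ (Real.log (1 / |y i|)) - y i * τ) -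
        (ybar * θ (Real.log (1 / |ybar|)) - ybar * τ) := by
    simp only [mul_sub, Finset.sum_sub_distrib, ← mul_assoc, ← Finset.sum_mul, ← hy]
    ring
  rw [e]
  refine (abs_sub _ _).trans ?_
  linarith

/-- Jensen's inequality up to a constant, for convex combinations of any length. -/
lemma IsOrliczFunction.exists_kpFunction_sum_le (h : IsOrliczFunction ψ) (hP : PowerBound ψ)
    (h2 : DeltaTwo ψ) (hθ : LipschitzWith K θ) :
    ∃ L, 1 ≤ L ∧ ∀ (m : ℕ) (α : Fin m → ℝ) (t : Fin m → ℝ × ℝ), (∀ i, 0 ≤ α i) → ∑ i, α i = 1 →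
      kpFunction ψ θ (∑ i, α i • t i) ≤ L * ∑ i, α i * kpFunction ψ θ (t i) := by
  obtain ⟨c, hc⟩ := h.exists_defect_le hP hθ
  obtain ⟨C, hC, hCc⟩ := h.exists_map_mul_le h2 c
  obtain ⟨D, hD, hDadd⟩ := h.exists_map_add_le h2
  have hC0 : 0 < C := by linarith
  have hD0 : 0 < D := by linarith
  refine ⟨1 + D + D * C, by nlinarith, fun m α t hα hα1 => ?_⟩
  have hB0 : 0 ≤ ∑ i, α i * ψ (t i).2 :=
    Finset.sum_nonneg fun i _ => mul_nonneg (hα i) (h.nonneg _)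
  obtain ⟨A, hA, hAB⟩ := h.exists_eq hB0
  have hdef := hc m α (fun i => (t i).2) hα hα1 A hA hAB
  set U : Fin m → ℝ := fun i => (t i).1 - (t i).2 * θ (Real.log (1 / |(t i).2|)) with hU
  set ybar := ∑ i, α i * (t i).2 with hy
  set R := ∑ i, α i * ((t i).2 * θ (Real.log (1 / |(t i).2|))) -
    ybar * θ (Real.log (1 / |ybar|)) with hR
  have hV0 : 0 ≤ ∑ i, α i * ψ (U i) :=
    Finset.sum_nonneg fun i _ => mul_nonneg (hα i) (h.nonneg _)
  have hJy : ψ ybar ≤ ∑ i, α i * ψ (t i).2 := by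
    simpa using h.convexOn_univ.map_sum_le (t := Finset.univ) (w := α) (p := fun i => (t i).2)
      (fun i _ => hα i) hα1 (fun i _ => mem_univ _)
  have hJU : ψ (∑ i, α i * U i) ≤ ∑ i, α i * ψ (U i) := by
    simpa using h.convexOn_univ.map_sum_le (t := Finset.univ) (w := α) (p := U)
      (fun i _ => hα i) hα1 (fun i _ => mem_univ _)
  have hRψ : ψ R ≤ C * ∑ i, α i * ψ (t i).2 := by
    rw [← hAB]
    exact (h.mono_abs (hdef.trans (le_abs_self _))).trans (hCc A)
  have hfst : (∑ i, α i • t i).1 = ∑ i, α i * (t i).1 := by simp [Prod.fst_sum]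
  have hsnd : (∑ i, α i • t i).2 = ybar := by simp [Prod.snd_sum, hy]
  have e1 : kpFunction ψ θ (∑ i, α i • t i) = ψ ybar + ψ (∑ i, α i * U i + R) := by
    simp only [kpFunction, hsnd, hfst]
    congr 2
    simp only [hU, hR, mul_sub, Finset.sum_sub_distrib]
    ring
  have e2 : ∑ i, α i * kpFunction ψ θ (t i) = ∑ i, α i * ψ (t i).2 + ∑ i, α i * ψ (U i) := by
    simp only [kpFunction, hU, mul_add, Finset.sum_add_distrib]
  rw [e1, e2]
  have h3 := hDadd (∑ i, α i * U i) R
  have h4 : D * (ψ (∑ i, α i * U i) + ψ R) ≤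
      D * (∑ i, α i * ψ (U i) + C * ∑ i, α i * ψ (t i).2) := by gcongr
  have h5 : 0 ≤ D * ∑ i, α i * ψ (t i).2 := by positivity
  have h6 : 0 ≤ D * C * ∑ i, α i * ψ (U i) := by positivity
  linarith

lemma IsOrliczFunction.isQuasiConvex_kpFunction (h : IsOrliczFunction ψ) (hP : PowerBound ψ)
    (h2 : DeltaTwo ψ) (hθ : LipschitzWith K θ) : IsQuasiConvex (kpFunction ψ θ) := by
  obtain ⟨L, hL, hLs⟩ := h.exists_kpFunction_sum_le hP h2 hθ
  refine ⟨L, by linarith, fun x y a b ha hb hab => ?_⟩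
  simpa [Fin.sum_univ_two] using hLs 2 ![a, b] ![x, y]
    (fun i => by fin_cases i <;> simpa) (by simpa [Fin.sum_univ_two])

lemma IsOrliczFunction.exists_kpFunction_le_convexEnvelope (h : IsOrliczFunction ψ)
    (hP : PowerBound ψ) (h2 : DeltaTwo ψ) (hθ : LipschitzWith K θ) :
    ∃ L, 1 ≤ L ∧ ∀ v, kpFunction ψ θ v ≤ L * convexEnvelope (kpFunction ψ θ) v := by
  obtain ⟨L, hL, hLs⟩ := h.exists_kpFunction_sum_le hP h2 hθ
  have hL0 : 0 < L := by linarith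
  refine ⟨L, hL, fun v => ?_⟩
  rw [← div_le_iff₀' hL0]
  refine le_csInf (nonempty_convexEnvelope _ _) ?_
  rintro _ ⟨m, α, t, hα, hα1, rfl, rfl⟩
  rw [div_le_iff₀' hL0]
  exact hLs m α t hα hα1

lemma IsOrliczFunction.exists_kpFunction_smul_le (h : IsOrliczFunction ψ) (h2 : DeltaTwo ψ)
    (hθ : LipschitzWith K θ) {c : ℝ} (hc : 0 < c) :
    ∃ C, 1 ≤ C ∧ ∀ v, kpFunction ψ θ (c • v) ≤ C * kpFunction ψ θ v := by
  obtain ⟨C, hC, hCc⟩ := h.exists_map_mul_le h2 c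
  obtain ⟨C', hC', hCc'⟩ := h.exists_map_mul_le h2 (K * (c * |Real.log c|))
  obtain ⟨D, hD, hDadd⟩ := h.exists_map_add_le h2
  have hD0 : 0 < D := by linarith
  refine ⟨C + D * C + D * C', by nlinarith, fun v => ?_⟩
  set u := v.1 - v.2 * θ (Real.log (1 / |v.2|)) with hu
  set r := (c * v.2) * θ (Real.log (1 / |v.2|)) - (c * v.2) * θ (Real.log (1 / |c * v.2|)) with hr
  have e1 : kpFunction ψ θ (c • v) = ψ (c * v.2) + ψ (c * u + r) := by
    have e3 : (c • v).1 = c * v.1 := rfl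
    have e4 : (c • v).2 = c * v.2 := rfl
    rw [kpFunction, e3, e4, hu, hr]
    congr 2
    ring
  have e2 : kpFunction ψ θ v = ψ v.2 + ψ u := rfl
  have hrψ : ψ r ≤ C' * ψ v.2 := by
    refine le_trans (h.mono_abs ?_) (hCc' v.2)
    have e3 : 1 / |v.2| = c / |c * v.2| := by
      rw [abs_mul, abs_of_pos hc]
      field_simp
    rw [hr, e3]
    refine (abs_mul_log_div_sub_le hθ hc one_pos _).trans (le_of_eq ?_)
    rw [div_one, abs_mul, abs_mul, abs_of_pos hc,
      abs_of_nonneg (by positivity : 0 ≤ K * (c * |Real.log c|))]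
    ring
  rw [e1, e2]
  have h3 := hDadd (c * u) r
  have h4 : D * (ψ (c * u) + ψ r) ≤ D * (C * ψ u + C' * ψ v.2) := by
    gcongr
    exact hCc u
  have h5 := hCc v.2
  have h6 : 0 ≤ D * C * ψ v.2 := mul_nonneg (by positivity) (h.nonneg _)
  have h7 : 0 ≤ D * C' * ψ u := mul_nonneg (by positivity) (h.nonneg _)
  have h8 : 0 ≤ C * ψ u := mul_nonneg (by positivity) (h.nonneg _)
  linarith

lemma IsOrliczFunction.exists_bound_of_kpFunction_le (h : IsOrliczFunction ψ)
    (hθ : LipschitzWith K θ) (B : ℝ) :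
    ∃ R, 1 ≤ R ∧ ∀ v, kpFunction ψ θ v ≤ B → |v.1| ≤ R ∧ |v.2| ≤ R := by
  obtain ⟨R, hR, hRB⟩ := h.le_of_map_le B
  have hR0 : 0 < R := by linarith
  have hpos : 0 ≤ R * |θ (Real.log (1 / R))| + K * R := by positivity
  refine ⟨R + (R * |θ (Real.log (1 / R))| + K * R), by linarith, fun v hv => ?_⟩
  set u := v.1 - v.2 * θ (Real.log (1 / |v.2|)) with hu
  have e2 : kpFunction ψ θ v = ψ v.2 + ψ u := rfl
  have hy : |v.2| ≤ R := hRB _ (by linarith [h.nonneg u])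
  have huR : |u| ≤ R := hRB _ (by linarith [h.nonneg v.2])
  refine ⟨?_, by linarith⟩
  have h1 : |v.2 * θ (Real.log (1 / |v.2|)) - v.2 * θ (Real.log (1 / R))| ≤ K * R :=
    (abs_mul_log_sub_mul_le hθ hR0 v.2).trans
      (mul_le_mul_of_nonneg_left (TwistedSum.abs_mul_abs_log_div_le hR0 hy) K.coe_nonneg)
  have h2 : |v.2 * θ (Real.log (1 / R))| ≤ R * |θ (Real.log (1 / R))| := by
    rw [abs_mul]; gcongr
  have e : v.1 = u + ((v.2 * θ (Real.log (1 / |v.2|)) - v.2 * θ (Real.log (1 / R))) +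
      v.2 * θ (Real.log (1 / R))) := by rw [hu]; ring
  rw [e]
  refine (abs_add_le _ _).trans (add_le_add huR ((abs_add_le _ _).trans ?_))
  linarith

lemma IsOrliczFunction.tendsto_kpFunction (h : IsOrliczFunction ψ) (θ : ℝ → ℝ) {v : ℝ × ℝ}
    (hv : v ≠ 0) : Tendsto (fun t : ℝ => kpFunction ψ θ (t • v)) atTop atTop := by
  have key : ∀ a : ℝ, a ≠ 0 → Tendsto (fun t : ℝ => ψ (t * a)) atTop atTop := fun a ha => by
    have h1 : Tendsto (fun t : ℝ => ψ (t * |a|)) atTop atTop :=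
      h.tendsto_atTop.comp (tendsto_id.atTop_mul_const (abs_pos.2 ha))
    refine h1.congr' ?_
    filter_upwards [eventually_ge_atTop (0 : ℝ)] with t ht
    rw [← h.map_abs (t * a), abs_mul, abs_of_nonneg ht]
  rcases eq_or_ne v.2 0 with h2 | h2
  · have h1 : v.1 ≠ 0 := fun h1 => hv (Prod.ext h1 h2)
    refine tendsto_atTop_mono (fun t => ?_) (key v.1 h1)
    simp [kpFunction, h2, h.map_zero]
  · refine tendsto_atTop_mono (fun t => ?_) (key v.2 h2)
    exact le_add_of_nonneg_right (h.nonneg _)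

lemma IsOrliczFunction.isYoungFunction_convexEnvelope (h : IsOrliczFunction ψ)
    (hP : PowerBound ψ) (h2 : DeltaTwo ψ) (hθ : LipschitzWith K θ) :
    IsYoungFunction (toENN (convexEnvelope (kpFunction ψ θ))) := by
  have h0 := kpFunction_nonneg h θ
  obtain ⟨L, hL, hLv⟩ := h.exists_kpFunction_le_convexEnvelope hP h2 hθ
  have hL0 : 0 < L := by linarith
  refine isYoungFunction_toENN (convexEnvelope_nonneg h0) (convexEnvelope_neg (kpFunction_neg h θ))
    (convexOn_convexEnvelope h0) (le_antisymm ?_ (convexEnvelope_nonneg h0 _)) fun v hv => ?_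
  · exact (convexEnvelope_le h0 0).trans (kpFunction_zero h θ).le
  · refine tendsto_atTop_mono (fun t => ?_) ((h.tendsto_kpFunction θ hv).atTop_div_const hL0)
    rw [div_le_iff₀' hL0]
    exact hLv _

end Function

/-! ### The twisted sum and the modular of `Φ` -/

section Twisted

variable {φ ψ θ : ℝ → ℝ} {K : ℝ≥0}

lemma IsOrliczFunction.exists_tsum_le_one_of_eqOn (hφ : IsOrliczFunction φ)
    (hψ : IsOrliczFunction ψ) (he : EqOn ψ φ (Icc 0 1)) :
    ∃ R : ℝ, 1 ≤ R ∧ ∀ (x : ℕ → ℝ) (ρ : ℝ), 0 < ρ → ∑' k, toENN ψ (ρ⁻¹ • x k) ≤ 1 →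
      ∑' k, toENN φ ((R * ρ)⁻¹ • x k) ≤ 1 := by
  obtain ⟨R, hR, hRB⟩ := hψ.le_of_map_le 1
  have hR0 : 0 < R := by linarith
  refine ⟨R, hR, fun x ρ hρ hx => le_trans (ENNReal.tsum_le_tsum fun k => ?_) hx⟩
  have h1 : |ρ⁻¹ • x k| ≤ R := by
    apply hRB
    rw [← ENNReal.ofReal_le_one]
    exact (ENNReal.le_tsum k).trans hx
  have h2 : (R * ρ)⁻¹ • x k = R⁻¹ * (ρ⁻¹ • x k) := by
    rw [smul_eq_mul, smul_eq_mul, mul_inv, mul_assoc]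
  have h3 : |R⁻¹ * (ρ⁻¹ • x k)| ≤ 1 := by
    rw [abs_mul, abs_of_pos (inv_pos.2 hR0), inv_mul_le_iff₀ hR0]
    linarith
  rw [h2]
  apply ENNReal.ofReal_le_ofReal
  rw [← hφ.map_abs, ← he ⟨abs_nonneg _, h3⟩]
  apply hψ.mono_abs
  rw [abs_abs, abs_mul, abs_of_pos (inv_pos.2 hR0)]
  exact mul_le_of_le_one_left (abs_nonneg _) (inv_le_one_of_one_le₀ hR)

/-- A bound on the modular of `ψ` bounds the norm of `ℓ_φ`. -/
lemma IsOrliczFunction.exists_orliczNorm_le (hφ : IsOrliczFunction φ) (hψ : IsOrliczFunction ψ)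
    (he : EqOn ψ φ (Icc 0 1)) :
    ∃ R : ℝ, 1 ≤ R ∧ ∀ (x : ℕ → ℝ) (ρ D : ℝ), 0 < ρ → 1 ≤ D →
      ∑' k, toENN ψ (ρ⁻¹ • x k) ≤ ENNReal.ofReal D →
      x ∈ orliczSpace φ ∧ orliczNorm φ x ≤ R * D * ρ := by
  obtain ⟨R, hR, hRx⟩ := hφ.exists_tsum_le_one_of_eqOn hψ he
  refine ⟨R, hR, fun x ρ D hρ hD hx => ?_⟩
  have h1 := hRx x (D * ρ) (by positivity) (hψ.isYoungFunction.tsum_mul_le_one hρ hD hx)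
  have h2 : 0 < R * (D * ρ) := by positivity
  rw [mul_assoc]
  exact ⟨mem_fenchelOrlicz_of_le_one h2 h1, luxemburg_le h2 h1⟩

/-- The norm of `ℓ_φ` bounds the modular of `ψ`. -/
lemma IsOrliczFunction.exists_tsum_le (hφ : IsOrliczFunction φ) (hψ : IsOrliczFunction ψ)
    (he : EqOn ψ φ (Icc 0 1)) (h2 : DeltaTwo ψ) :
    ∃ C : ℝ, 1 ≤ C ∧ ∀ x ∈ orliczSpace φ, ∀ ρ : ℝ, 0 < ρ → orliczNorm φ x ≤ ρ →
      ∑' k, toENN ψ (ρ⁻¹ • x k) ≤ ENNReal.ofReal C := by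
  obtain ⟨R, hR, hRx⟩ := hψ.exists_tsum_le_one_of_eqOn hφ fun x hx => (he hx).symm
  obtain ⟨C, hC, hCc⟩ := hψ.exists_map_mul_le h2 (R * 2)
  have hC0 : 0 ≤ C := by linarith
  refine ⟨C, hC, fun x hx ρ hρ hxρ => ?_⟩
  -- The factor `2` makes the inequality strict, so that `2 * ρ` is admissible for `x`.
  have hlt : orliczNorm φ x < 2 * ρ := by linarith
  have h3 := hRx x (2 * ρ) (by positivity) (hφ.isYoungFunction.tsum_le_one_of_luxemburg_lt hx hlt)
  calc ∑' k, toENN ψ (ρ⁻¹ • x k)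
      ≤ ∑' k, ENNReal.ofReal C * toENN ψ ((R * (2 * ρ))⁻¹ • x k) := by
        refine ENNReal.tsum_le_tsum fun k => ?_
        rw [toENN, toENN, ← ENNReal.ofReal_mul hC0]
        apply ENNReal.ofReal_le_ofReal
        convert hCc ((R * (2 * ρ))⁻¹ • x k) using 2
        simp only [smul_eq_mul]
        field_simp
    _ ≤ ENNReal.ofReal C := by
        rw [ENNReal.tsum_mul_left]
        exact mul_le_of_le_one_right zero_le h3

lemma IsOrliczFunction.eq_zero_of_orliczNorm (hφ : IsOrliczFunction φ) {x : ℕ → ℝ}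
    (hx : x ∈ orliczSpace φ) (h0 : orliczNorm φ x = 0) : x = 0 := by
  obtain ⟨R, hR, hRB⟩ := hφ.le_of_map_le 1
  have hR0 : 0 < R := by linarith
  funext k
  refine abs_eq_zero.1 (le_antisymm (le_of_forall_pos_le_add fun ε hε => ?_) (abs_nonneg _))
  have hlt : luxemburg (toENN φ) x < ε / R := by
    change orliczNorm φ x < _
    rw [h0]; positivity
  have h1 := hφ.isYoungFunction.tsum_le_one_of_luxemburg_lt hx hlt
  have h2 : |(ε / R)⁻¹ • x k| ≤ R := by
    apply hRB
    rw [← ENNReal.ofReal_le_one]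
    exact (ENNReal.le_tsum k).trans h1
  rw [smul_eq_mul, abs_mul, abs_of_pos (by positivity), inv_mul_le_iff₀ (by positivity),
    div_mul_cancel₀ _ hR0.ne'] at h2
  simpa using h2

lemma mul_abs_log_le {t L : ℝ} (ht : 0 < t) (htL : t ≤ L) : t * |Real.log t| ≤ 1 + L ^ 2 := by
  rcases le_total t 1 with h | h
  · have := Real.abs_log_mul_self_lt t ht h
    rw [abs_mul, abs_of_pos ht] at this
    nlinarith [sq_nonneg L]
  · rw [abs_of_nonneg (Real.log_nonneg h)]
    have := Real.log_le_sub_one_of_pos ht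
    nlinarith

/-- At scale `ρ`, the second term of `Φ` may be computed with `F(y)`, at the cost of an error with
bounded modular, as long as the norm of `y` is at most a multiple of `ρ`. -/
lemma IsOrliczFunction.exists_tsum_error_le (hφ : IsOrliczFunction φ) (hψ : IsOrliczFunction ψ)
    (he : EqOn ψ φ (Icc 0 1)) (h2 : DeltaTwo ψ) (hθ : LipschitzWith K θ) (L : ℝ) :
    ∃ C : ℝ, 1 ≤ C ∧ ∀ (z : ℕ → ℝ × ℝ) (ρ : ℝ), 0 < ρ → (fun n => (z n).2) ∈ orliczSpace φ →
      orliczNorm φ (fun n => (z n).2) ≤ L * ρ →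
      ∑' k, toENN ψ (ρ⁻¹ * ((z k).1 - kpMap φ θ (fun m => (z m).2) k) -
        ((ρ⁻¹ • z k).1 - (ρ⁻¹ • z k).2 * θ (Real.log (1 / |(ρ⁻¹ • z k).2|)))) ≤
          ENNReal.ofReal C := by
  obtain ⟨C, hC, hCx⟩ := hφ.exists_tsum_le hψ he h2
  obtain ⟨D, hD, hDc⟩ := hψ.exists_map_mul_le h2 (K * (1 + L ^ 2))
  have hD0 : 0 ≤ D := by linarith
  refine ⟨D * C, by nlinarith, fun z ρ hρ hy hyL => ?_⟩
  set y : ℕ → ℝ := fun n => (z n).2 with hydef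
  set s := orliczNorm φ y with hs
  have hs0 : 0 ≤ s := luxemburg_nonneg y
  have herr : ∀ k, ρ⁻¹ * ((z k).1 - kpMap φ θ y k) -
      ((ρ⁻¹ • z k).1 - (ρ⁻¹ • z k).2 * θ (Real.log (1 / |(ρ⁻¹ • z k).2|))) =
      -(ρ⁻¹ * (y k * θ (Real.log (s / |y k|)) - y k * θ (Real.log (ρ / |y k|)))) := fun k => by
    have e1 : 1 / |(ρ⁻¹ • z k).2| = ρ / |y k| := by
      rw [Prod.smul_snd, smul_eq_mul, abs_mul, abs_of_pos (inv_pos.2 hρ), one_div, mul_inv,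
        inv_inv, div_eq_mul_inv]
    rw [e1, Prod.smul_snd, Prod.smul_fst, smul_eq_mul, smul_eq_mul, kpMap]
    ring
  -- For `s = 0` the logarithms take junk values, but then `y = 0`.
  rcases hs0.eq_or_lt with h0 | hspos
  · have hy0 := hφ.eq_zero_of_orliczNorm hy h0.symm
    have : ∀ k, y k = 0 := fun k => congrFun hy0 k
    simp_rw [herr, this]
    simp [toENN, hψ.map_zero]
  calc _ ≤ ∑' k, ENNReal.ofReal D * toENN ψ (s⁻¹ • y k) := by
        refine ENNReal.tsum_le_tsum fun k => ?_
        rw [herr, toENN, toENN, ← ENNReal.ofReal_mul hD0, hψ.even]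
        refine ENNReal.ofReal_le_ofReal (le_trans (hψ.mono_abs ?_) (hDc (s⁻¹ • y k)))
        have h3 := abs_mul_log_div_sub_le hθ hspos hρ (y k)
        have h4 : s / ρ * |Real.log (s / ρ)| ≤ 1 + L ^ 2 :=
          mul_abs_log_le (by positivity) ((div_le_iff₀ hρ).2 hyL)
        rw [abs_mul, abs_of_pos (inv_pos.2 hρ), abs_mul (K * (1 + L ^ 2)), smul_eq_mul,
          abs_mul s⁻¹, abs_of_pos (inv_pos.2 hspos),
          abs_of_nonneg (by positivity : 0 ≤ K * (1 + L ^ 2))]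
        calc _ ≤ ρ⁻¹ * (K * (|y k| * |Real.log (s / ρ)|)) := by gcongr
          _ = K * (s / ρ * |Real.log (s / ρ)|) * (s⁻¹ * |y k|) := by field_simp
          _ ≤ _ := by gcongr
    _ ≤ ENNReal.ofReal (D * C) := by
        rw [ENNReal.tsum_mul_left, ENNReal.ofReal_mul hD0]
        gcongr
        exact hCx y hy s hspos le_rfl

lemma IsOrliczFunction.exists_tsum_le_of_sub (hψ : IsOrliczFunction ψ) (h2 : DeltaTwo ψ) :
    ∃ D : ℝ, 1 ≤ D ∧ ∀ (a b : ℕ → ℝ) (A B : ℝ), 0 ≤ A → 0 ≤ B →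
      ∑' k, toENN ψ (a k) ≤ ENNReal.ofReal A → ∑' k, toENN ψ (b k - a k) ≤ ENNReal.ofReal B →
      ∑' k, toENN ψ (b k) ≤ ENNReal.ofReal (D * (A + B)) := by
  obtain ⟨D, hD, hDadd⟩ := hψ.exists_map_add_le h2
  have hD0 : 0 ≤ D := by linarith
  refine ⟨D, hD, fun a b A B hA hB ha hb => ?_⟩
  calc _ ≤ ∑' k, ENNReal.ofReal D * (toENN ψ (a k) + toENN ψ (b k - a k)) := by
        refine ENNReal.tsum_le_tsum fun k => ?_
        rw [toENN, toENN, toENN, ← ENNReal.ofReal_add (hψ.nonneg _) (hψ.nonneg _),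
          ← ENNReal.ofReal_mul hD0]
        apply ENNReal.ofReal_le_ofReal
        have := hDadd (a k) (b k - a k)
        rwa [add_sub_cancel] at this
    _ ≤ _ := by
        rw [ENNReal.tsum_mul_left, ENNReal.tsum_add, ENNReal.ofReal_mul hD0,
          ENNReal.ofReal_add hA hB]
        gcongr

lemma IsOrliczFunction.tsum_kpFunction (hψ : IsOrliczFunction ψ) (θ : ℝ → ℝ) (z : ℕ → ℝ × ℝ) :
    ∑' k, toENN (kpFunction ψ θ) (z k) = ∑' k, toENN ψ (z k).2 +
      ∑' k, toENN ψ ((z k).1 - (z k).2 * θ (Real.log (1 / |(z k).2|))) := by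
  rw [← ENNReal.tsum_add]
  exact tsum_congr fun k => ENNReal.ofReal_add (hψ.nonneg _) (hψ.nonneg _)

lemma IsOrliczFunction.exists_tsum_kpFunction_le (hφ : IsOrliczFunction φ)
    (hψ : IsOrliczFunction ψ) (he : EqOn ψ φ (Icc 0 1)) (h2 : DeltaTwo ψ)
    (hθ : LipschitzWith K θ) :
    ∃ C : ℝ, 1 ≤ C ∧ ∀ z ∈ twistedSum φ θ, ∀ ρ : ℝ, 0 < ρ → twistedNorm φ θ z ≤ ρ →
      ∑' k, toENN (kpFunction ψ θ) (ρ⁻¹ • z k) ≤ ENNReal.ofReal C := by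
  obtain ⟨C₀, hC₀, hC₀x⟩ := hφ.exists_tsum_le hψ he h2
  obtain ⟨C₁, hC₁, hC₁x⟩ := hφ.exists_tsum_error_le hψ he h2 hθ 1
  obtain ⟨D, hD, hDx⟩ := hψ.exists_tsum_le_of_sub h2
  refine ⟨C₀ + D * (C₀ + C₁), by nlinarith, ?_⟩
  rintro z ⟨hy, hx⟩ ρ hρ hzρ
  have hN1 : 0 ≤ orliczNorm φ (fun n => (z n).2) := luxemburg_nonneg _
  have hN2 : 0 ≤ orliczNorm φ (fun n => (z n).1 - kpMap φ θ (fun m => (z m).2) n) :=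
    luxemburg_nonneg _
  rw [twistedNorm] at hzρ
  rw [hψ.tsum_kpFunction, ENNReal.ofReal_add (by linarith) (by nlinarith)]
  refine add_le_add (hC₀x _ hy ρ hρ (by linarith)) ?_
  refine hDx _ _ C₀ C₁ (by linarith) (by linarith) (hC₀x _ hx ρ hρ (by linarith)) ?_
  convert hC₁x z ρ hρ hy (by linarith) using 3 with k
  rw [toENN, toENN, ← hψ.even, neg_sub, smul_eq_mul]

lemma IsOrliczFunction.exists_twistedNorm_le (hφ : IsOrliczFunction φ)
    (hψ : IsOrliczFunction ψ) (he : EqOn ψ φ (Icc 0 1)) (h2 : DeltaTwo ψ)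
    (hθ : LipschitzWith K θ) {B : ℝ} (hB : 1 ≤ B) :
    ∃ C : ℝ, 1 ≤ C ∧ ∀ (z : ℕ → ℝ × ℝ) (ρ : ℝ), 0 < ρ →
      ∑' k, toENN (kpFunction ψ θ) (ρ⁻¹ • z k) ≤ ENNReal.ofReal B →
      z ∈ twistedSum φ θ ∧ twistedNorm φ θ z ≤ C * ρ := by
  obtain ⟨R, hR, hRx⟩ := hφ.exists_orliczNorm_le hψ he
  obtain ⟨C₁, hC₁, hC₁x⟩ := hφ.exists_tsum_error_le hψ he h2 hθ (R * B)
  obtain ⟨D, hD, hDx⟩ := hψ.exists_tsum_le_of_sub h2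
  have hDB : 1 ≤ D * (B + C₁) := by nlinarith
  refine ⟨R * B + R * (D * (B + C₁)), by nlinarith, fun z ρ hρ hz => ?_⟩
  rw [hψ.tsum_kpFunction] at hz
  obtain ⟨hy, hyn⟩ := hRx (fun n => (z n).2) ρ B hρ hB (le_self_add.trans hz)
  have h3 := hDx _ _ B C₁ (by linarith) (by linarith) (le_add_self.trans hz)
    (hC₁x z ρ hρ hy hyn)
  obtain ⟨hx, hxn⟩ := hRx _ ρ _ hρ hDB h3
  refine ⟨⟨hy, hx⟩, ?_⟩
  rw [twistedNorm, add_mul]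
  exact add_le_add hyn hxn

/-- The twisted sum is the Fenchel–Orlicz space of the convex envelope of `Φ`. -/
lemma IsOrliczFunction.isFenchelOrliczVia (hφ : IsOrliczFunction φ)
    (hψ : IsOrliczFunction ψ) (he : EqOn ψ φ (Icc 0 1)) (hP : PowerBound ψ) (h2 : DeltaTwo ψ)
    (hθ : LipschitzWith K θ) :
    IsFenchelOrliczVia (toENN (convexEnvelope (kpFunction ψ θ)))
      (twistedSum φ θ) (twistedNorm φ θ) := by
  have hY := hψ.isYoungFunction_convexEnvelope hP h2 hθ
  obtain ⟨L, hL, hLv⟩ := hψ.exists_kpFunction_le_convexEnvelope hP h2 hθ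
  obtain ⟨C, hC, hCz⟩ := hφ.exists_tsum_kpFunction_le hψ he h2 hθ
  obtain ⟨C', hC', hCz'⟩ := hφ.exists_twistedNorm_le hψ he h2 hθ hL
  have hL0 : 0 ≤ L := by linarith
  have hC0 : 0 < C := by linarith
  have hC0' : 0 < C' := by linarith
  have hle : ∀ z ∈ twistedSum φ θ, ∀ ρ : ℝ, 0 < ρ → twistedNorm φ θ z ≤ ρ →
      ∑' k, toENN (convexEnvelope (kpFunction ψ θ)) (ρ⁻¹ • z k) ≤ ENNReal.ofReal C :=
    fun z hz ρ hρ hzρ => (ENNReal.tsum_le_tsum fun k =>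
      ENNReal.ofReal_le_ofReal (convexEnvelope_le (kpFunction_nonneg hψ θ) _)).trans
        (hCz z hz ρ hρ hzρ)
  have hge : ∀ (z : ℕ → ℝ × ℝ) (ρ : ℝ), 0 < ρ →
      ∑' k, toENN (convexEnvelope (kpFunction ψ θ)) (ρ⁻¹ • z k) ≤ 1 →
      z ∈ twistedSum φ θ ∧ twistedNorm φ θ z ≤ C' * ρ := fun z ρ hρ hz => by
    refine hCz' z ρ hρ ?_
    calc _ ≤ ∑' k, ENNReal.ofReal L *
          toENN (convexEnvelope (kpFunction ψ θ)) (ρ⁻¹ • z k) := by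
          refine ENNReal.tsum_le_tsum fun k => ?_
          rw [toENN, toENN, ← ENNReal.ofReal_mul hL0]
          exact ENNReal.ofReal_le_ofReal (hLv _)
      _ ≤ _ := by
          rw [ENNReal.tsum_mul_left]
          exact mul_le_of_le_one_right zero_le hz
  have hN0 : ∀ z, 0 ≤ twistedNorm φ θ z := fun z =>
    add_nonneg (luxemburg_nonneg _) (luxemburg_nonneg _)
  have hmem : ∀ z ∈ twistedSum φ θ,
      z ∈ fenchelOrlicz (toENN (convexEnvelope (kpFunction ψ θ))) := fun z hz =>
    ⟨twistedNorm φ θ z + 1, by linarith [hN0 z],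
      (hle z hz _ (by linarith [hN0 z]) (by linarith)).trans_lt ENNReal.ofReal_lt_top⟩
  refine ⟨hY, Subset.antisymm hmem fun z hz => ?_, C⁻¹, C', by positivity, hC0', fun z hz =>
    ⟨?_, ?_⟩⟩
  · obtain ⟨ρ, hρ, hρz⟩ := hY.exists_tsum_le_one hz
    exact (hge z ρ hρ hρz).1
  · rw [inv_mul_le_iff₀ hC0, ← div_le_iff₀' hC0]
    refine le_of_forall_gt_imp_ge_of_dense fun ρ hρ => ?_
    have hρ0 : 0 < ρ := (hN0 z).trans_lt hρ
    rw [div_le_iff₀' hC0]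
    exact luxemburg_le (by positivity) (hY.tsum_mul_le_one hρ0 hC (hle z hz ρ hρ0 hρ.le))
  · rw [← div_le_iff₀' hC0']
    refine le_luxemburg hY (hmem z hz) fun ρ hρ hρz => ?_
    rw [div_le_iff₀' hC0']
    exact (hge z ρ hρ hρz).2

lemma kpMap_smul (hφ : IsOrliczFunction φ) (θ : ℝ → ℝ) (c : ℝ) (y : ℕ → ℝ) :
    kpMap φ θ (c • y) = c • kpMap φ θ y := by
  rcases eq_or_ne c 0 with rfl | hc
  · funext n; simp [kpMap]
  funext n
  have h1 : orliczNorm φ (c • y) = |c| * orliczNorm φ y := hφ.isYoungFunction.luxemburg_smul c y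
  simp only [kpMap, Pi.smul_apply, smul_eq_mul, h1]
  rw [abs_mul, mul_div_mul_left _ _ (abs_pos.2 hc).ne', mul_assoc]

lemma twistedNorm_smul (hφ : IsOrliczFunction φ) (θ : ℝ → ℝ) (c : ℝ) (z : ℕ → ℝ × ℝ) :
    twistedNorm φ θ (c • z) = |c| * twistedNorm φ θ z := by
  have e1 : (fun n => ((c • z) n).2) = c • fun n => (z n).2 := rfl
  have e2 : (fun n => ((c • z) n).1 - kpMap φ θ (fun m => ((c • z) m).2) n) =
      c • fun n => (z n).1 - kpMap φ θ (fun m => (z m).2) n := by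
    funext n
    rw [e1, kpMap_smul hφ]
    simp only [Pi.smul_apply, Prod.smul_fst, smul_eq_mul]
    ring
  rw [twistedNorm, twistedNorm, e2, e1, mul_add]
  exact congrArg₂ (· + ·) (hφ.isYoungFunction.luxemburg_smul c _)
    (hφ.isYoungFunction.luxemburg_smul c _)

end Twisted

/-! ### Completeness and density -/

lemma norm_le_mul_luxemburg {E : Type*} [NormedAddCommGroup E] [NormedSpace ℝ E] {g : E → ℝ}
    (hY : IsYoungFunction (toENN g)) {R : ℝ} (hR : 0 ≤ R) (hgR : ∀ v, g v ≤ 1 → ‖v‖ ≤ R)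
    {x : ℕ → E} (hx : x ∈ fenchelOrlicz (toENN g)) (k : ℕ) :
    ‖x k‖ ≤ R * luxemburg (toENN g) x := by
  have key : ∀ ρ, luxemburg (toENN g) x < ρ → ‖x k‖ ≤ R * ρ := fun ρ hρ => by
    have hρ0 : 0 < ρ := (luxemburg_nonneg x).trans_lt hρ
    have h1 := hY.tsum_le_one_of_luxemburg_lt hx hρ
    have h2 : ‖ρ⁻¹ • x k‖ ≤ R := by
      apply hgR
      rw [← ENNReal.ofReal_le_one]
      exact (ENNReal.le_tsum k).trans h1
    rw [norm_smul, norm_inv, Real.norm_of_nonneg hρ0.le, inv_mul_le_iff₀ hρ0] at h2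
    linarith
  refine le_of_forall_pos_le_add fun ε hε => ?_
  have h3 := key (luxemburg (toENN g) x + ε / (R + 1)) (by simp; positivity)
  refine h3.trans ?_
  rw [mul_add]
  have : R * (ε / (R + 1)) ≤ ε := by
    rw [mul_div_assoc', div_le_iff₀ (by positivity)]
    nlinarith
  linarith

/-- A homogeneous functional that is equivalent to the Luxemburg norm of a continuous Young's
function with bounded sublevel set and the doubling property is a complete quasi-norm, and the
finitely supported sequences are dense. -/
lemma IsFenchelOrliczVia.isCompletionOf {g : ℝ × ℝ → ℝ} {S : Set (ℕ → ℝ × ℝ)}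
    {N : (ℕ → ℝ × ℝ) → ℝ} (h : IsFenchelOrliczVia (toENN g) S N) (hg : Continuous g)
    (hg0 : g 0 = 0) {R : ℝ} (hR : 0 ≤ R) (hgR : ∀ v, g v ≤ 1 → ‖v‖ ≤ R)
    (hdbl : ∀ c : ℝ, 0 < c → ∃ C : ℝ, 0 ≤ C ∧ ∀ v, g (c • v) ≤ C * g v)
    (hN : ∀ (c : ℝ) (z : ℕ → ℝ × ℝ), N (c • z) = |c| * N z) :
    IsCompletionOf cZeroZero S N := by
  obtain ⟨hY, rfl, c, C, hc, hC, hcC⟩ := h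
  have hsub : ∀ {x y : ℕ → ℝ × ℝ}, x ∈ fenchelOrlicz (toENN g) → y ∈ fenchelOrlicz (toENN g) →
      x - y ∈ fenchelOrlicz (toENN g) := fun {x y} hx hy => by
    have := hY.add_mem hx (hY.smul_mem (-1) hy)
    rwa [neg_one_smul, ← sub_eq_add_neg] at this
  have hfin : cZeroZero ⊆ fenchelOrlicz (toENN g) := fun z hz =>
    mem_fenchelOrlicz_of_finite_support hg0 hz
  refine ⟨⟨hfin (by simp [cZeroZero]), fun z hz w hw => hY.add_mem hz hw,
    fun a z hz => hY.smul_mem a hz, fun z hz => ?_, fun z hz => ⟨fun h0 => ?_, ?_⟩,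
    fun a z _ => hN a z, C / c, fun z hz w hw => ?_⟩, hfin, fun z hz ε hε => ?_,
    fun u hu hcau => ?_⟩
  · exact (mul_nonneg hc.le (luxemburg_nonneg z)).trans (hcC z hz).1
  · have h1 := (hcC z hz).1
    rw [h0] at h1
    have h2 : luxemburg (toENN g) z = 0 :=
      le_antisymm (nonpos_of_mul_nonpos_right h1 hc) (luxemburg_nonneg z)
    funext k
    have := norm_le_mul_luxemburg hY hR hgR hz k
    rw [h2, mul_zero] at this
    exact norm_le_zero_iff.1 this
  · rintro rfl
    have := hN 0 0
    simpa using this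
  · have h1 := (hcC _ (hY.add_mem hz hw)).2
    have h2 := hY.luxemburg_add_le hz hw
    have h3 := (hcC z hz).1
    have h4 := (hcC w hw).1
    calc N (z + w) ≤ C * luxemburg (toENN g) (z + w) := h1
      _ ≤ C * (luxemburg (toENN g) z + luxemburg (toENN g) w) := by gcongr
      _ = C / c * (c * luxemburg (toENN g) z + c * luxemburg (toENN g) w) := by field_simp
      _ ≤ C / c * (N z + N w) := by gcongr
  · set δ := ε / (2 * C) with hδ
    have hδ0 : 0 < δ := by positivity
    obtain ⟨ρ, hρ, hρz⟩ := hz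
    obtain ⟨D, hD0, hD⟩ := hdbl (ρ / δ) (by positivity)
    have hfinite : ∑' k, toENN g (δ⁻¹ • z k) ≠ ⊤ := by
      refine ne_top_of_le_ne_top (b := ENNReal.ofReal D * ∑' k, toENN g (ρ⁻¹ • z k))
        (ENNReal.mul_ne_top ENNReal.ofReal_ne_top hρz.ne) ?_
      rw [← ENNReal.tsum_mul_left]
      refine ENNReal.tsum_le_tsum fun k => ?_
      rw [toENN, toENN, ← ENNReal.ofReal_mul hD0]
      apply ENNReal.ofReal_le_ofReal
      convert hD (ρ⁻¹ • z k) using 2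
      rw [smul_smul]
      congr 1
      field_simp
    obtain ⟨s, hs⟩ := ((ENNReal.tendsto_tsum_compl_atTop_zero hfinite).eventually
      (ge_mem_nhds one_pos)).exists
    set w : ℕ → ℝ × ℝ := fun k => if k ∈ s then z k else 0 with hw
    have hwfin : w ∈ cZeroZero := (Finset.finite_toSet s).subset fun k hk => by
      by_contra hks
      exact hk (if_neg hks)
    have hmod : ∑' k, toENN g (δ⁻¹ • (z - w) k) ≤ 1 := by
      refine le_trans (le_of_eq ?_) hs
      refine Eq.trans ?_ (tsum_subtype {k | k ∉ s} fun k => toENN g (δ⁻¹ • z k)).symm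
      refine tsum_congr fun k => ?_
      by_cases hk : k ∈ s
      · simp [hw, hk, toENN, hg0]
      · simp [hw, hk]
    refine ⟨w, hwfin, ?_⟩
    have h1 := (hcC (z - w) (mem_fenchelOrlicz_of_le_one hδ0 hmod)).2
    have h2 := mul_le_mul_of_nonneg_left (luxemburg_le hδ0 hmod) hC.le
    have h3 : C * δ = ε / 2 := by rw [hδ]; field_simp
    linarith
  · have hlux : ∀ ε > 0, ∃ n₀, ∀ m ≥ n₀, ∀ n ≥ n₀, luxemburg (toENN g) (u m - u n) < ε := by
      intro ε hε
      obtain ⟨n₀, hn₀⟩ := hcau (c * ε) (by positivity)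
      refine ⟨n₀, fun m hm n hn => ?_⟩
      have h1 := (hcC _ (hsub (hu m) (hu n))).1
      exact lt_of_mul_lt_mul_left (h1.trans_lt (hn₀ m hm n hn)) hc.le
    have hcoord : ∀ k, ∃ v, Tendsto (fun n => u n k) atTop (𝓝 v) := fun k => by
      refine cauchySeq_tendsto_of_complete (Metric.cauchySeq_iff.2 fun ε hε => ?_)
      obtain ⟨n₀, hn₀⟩ := hlux (ε / (R + 1)) (by positivity)
      refine ⟨n₀, fun m hm n hn => ?_⟩
      have h1 := norm_le_mul_luxemburg hY hR hgR (hsub (hu m) (hu n)) k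
      have h2 := hn₀ m hm n hn
      have h3 : (0 : ℝ) ≤ luxemburg (toENN g) (u m - u n) := luxemburg_nonneg _
      rw [lt_div_iff₀ (by positivity)] at h2
      rw [dist_eq_norm]
      rw [Pi.sub_apply] at h1
      rcases h3.eq_or_lt with h4 | h4
      · rw [← h4, mul_zero] at h1; linarith
      · nlinarith
    choose z hz using hcoord
    have hlim : ∀ ε : ℝ, 0 < ε → ∃ n₀, ∀ m ≥ n₀, ∑' k, toENN g (ε⁻¹ • (u m - z) k) ≤ 1 := by
      intro ε hε
      obtain ⟨n₀, hn₀⟩ := hlux ε hε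
      refine ⟨n₀, fun m hm => ?_⟩
      -- Finite partial sums pass to the limit, since `g` is continuous.
      rw [ENNReal.tsum_eq_iSup_sum]
      refine iSup_le fun s => ?_
      have hcont : Continuous (toENN g) := ENNReal.continuous_ofReal.comp hg
      have ht : Tendsto (fun n => ∑ k ∈ s, toENN g (ε⁻¹ • (u m - u n) k)) atTop
          (𝓝 (∑ k ∈ s, toENN g (ε⁻¹ • (u m - z) k))) := by
        refine tendsto_finsetSum _ fun k _ => ?_
        exact (hcont.tendsto _).comp ((tendsto_const_nhds.sub (hz k)).const_smul _)
      refine le_of_tendsto ht ?_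
      filter_upwards [eventually_ge_atTop n₀] with n hn
      exact (ENNReal.sum_le_tsum s).trans
        (hY.tsum_le_one_of_luxemburg_lt (hsub (hu m) (hu n)) (hn₀ m hm n hn))
    obtain ⟨n₁, hn₁⟩ := hlim 1 one_pos
    have hzmem : z ∈ fenchelOrlicz (toENN g) := by
      have := hsub (hu n₁) (mem_fenchelOrlicz_of_le_one one_pos (hn₁ n₁ le_rfl))
      rwa [sub_sub_cancel] at this
    refine ⟨z, hzmem, Metric.tendsto_atTop.2 fun ε hε => ?_⟩
    obtain ⟨n₀, hn₀⟩ := hlim (ε / (2 * C)) (by positivity)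
    refine ⟨n₀, fun n hn => ?_⟩
    have hmem := hsub (hu n) hzmem
    have h1 := hcC _ hmem
    have h2 := mul_le_mul_of_nonneg_left (luxemburg_le (by positivity) (hn₀ n hn)) hC.le
    have h3 : C * (ε / (2 * C)) = ε / 2 := by field_simp
    have h4 := mul_nonneg hc.le (luxemburg_nonneg (Ψ := toENN g) (u n - z))
    rw [Real.dist_eq, sub_zero, abs_of_nonneg (h4.trans h1.1)]
    linarith [h1.2]

lemma IsOrliczFunction.isCompletionOf_twistedSum {φ ψ θ : ℝ → ℝ} {K : ℝ≥0}
    (hφ : IsOrliczFunction φ) (hψ : IsOrliczFunction ψ) (he : EqOn ψ φ (Icc 0 1))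
    (hP : PowerBound ψ) (h2 : DeltaTwo ψ) (hθ : LipschitzWith K θ) :
    IsCompletionOf cZeroZero (twistedSum φ θ) (twistedNorm φ θ) := by
  have h0 := kpFunction_nonneg hψ θ
  obtain ⟨L, hL, hLv⟩ := hψ.exists_kpFunction_le_convexEnvelope hP h2 hθ
  obtain ⟨R, hR, hRv⟩ := hψ.exists_bound_of_kpFunction_le hθ L
  have hL0 : 0 ≤ L := by linarith
  refine (hφ.isFenchelOrliczVia hψ he hP h2 hθ).isCompletionOf
    (continuousOn_univ.1 ((convexOn_convexEnvelope h0).continuousOn isOpen_univ))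
    (le_antisymm ((convexEnvelope_le h0 0).trans (kpFunction_zero hψ θ).le)
      (convexEnvelope_nonneg h0 _))
    (by linarith : 0 ≤ R) (fun v hv => ?_) (fun c hc => ?_) (twistedNorm_smul hφ θ)
  · have h1 := hRv v ((hLv v).trans (mul_le_of_le_one_right hL0 hv))
    exact max_le h1.1 h1.2
  · obtain ⟨C, hC, hCv⟩ := hψ.exists_kpFunction_smul_le h2 hθ hc
    refine ⟨C * L, by positivity, fun v => ?_⟩
    calc _ ≤ kpFunction ψ θ (c • v) := convexEnvelope_le h0 _
      _ ≤ C * kpFunction ψ θ v := hCv v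
      _ ≤ C * (L * convexEnvelope (kpFunction ψ θ) v) := by gcongr; exact hLv v
      _ = _ := by ring

/-! ### Powers -/

lemma isOrliczFunction_abs_rpow {p : ℝ} (hp : 1 < p) : IsOrliczFunction fun x => |x| ^ p where
  convexOn := (convexOn_rpow hp.le).congr fun x hx => by
    simp only [abs_of_nonneg (mem_Ici.1 hx)]
  monotoneOn x hx y hy hxy := by
    simp only [abs_of_nonneg (mem_Ici.1 hx), abs_of_nonneg (mem_Ici.1 hy)]
    exact Real.rpow_le_rpow hx hxy (by linarith)
  map_zero := by simp [Real.zero_rpow (by linarith : p ≠ 0)]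
  tendsto_atTop := (tendsto_rpow_atTop (by linarith)).comp tendsto_abs_atTop_atTop
  pos x hx := by positivity
  even x := by simp

lemma powerBound_abs_rpow {p : ℝ} (hp : 1 < p) : PowerBound fun x => |x| ^ p :=
  ⟨p, hp, 1, one_pos, fun l s hl _ hs => by
    beta_reduce
    rw [abs_mul, abs_of_pos hl, abs_of_pos hs, Real.mul_rpow hl.le hs.le, one_mul]⟩

lemma deltaTwo_abs_rpow (p : ℝ) : DeltaTwo fun x => |x| ^ p :=
  ⟨2 ^ p, by positivity, fun x hx => by
    beta_reduce
    rw [abs_mul, abs_of_nonneg hx, abs_two, Real.mul_rpow zero_le_two hx]⟩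

end TwistedSum

theorem mainTheorem1 :
    -- the twisted sum of an Orlicz space with non-trivial type with itself
    (∀ φ θ : ℝ → ℝ, IsOrliczFunction φ →
      HasNontrivialType (orliczSpace φ) (orliczNorm φ) →
      (∃ K : ℝ≥0, LipschitzWith K θ) →
        IsCompletionOf cZeroZero (twistedSum φ θ) (twistedNorm φ θ) ∧
        (∃ Ψ : ℝ × ℝ → ℝ≥0∞, IsFenchelOrliczVia Ψ (twistedSum φ θ) (twistedNorm φ θ)) ∧
        -- moreover, `Ψ` is the convex envelope of the quasi-convex function built from any
        -- sufficiently regular Orlicz function generating the same space, and these exist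
        (∃ ψ : ℝ → ℝ, IsOrliczFunction ψ ∧ EqOn ψ φ (Icc 0 1) ∧ PowerBound ψ ∧ DeltaTwo ψ) ∧
        (∀ ψ : ℝ → ℝ, IsOrliczFunction ψ → EqOn ψ φ (Icc 0 1) → PowerBound ψ → DeltaTwo ψ →
          IsQuasiConvex (kpFunction ψ θ) ∧
          IsFenchelOrliczVia (toENN (convexEnvelope (kpFunction ψ θ)))
            (twistedSum φ θ) (twistedNorm φ θ))) ∧
    -- the spaces `Z_p`
    (∀ p : ℝ, 1 < p →
      IsCompletionOf cZeroZero (twistedSum (fun x => |x| ^ p) id)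
        (twistedNorm (fun x => |x| ^ p) id) ∧
      IsFenchelOrliczVia (toENN (convexEnvelope (kpFunction (fun x => |x| ^ p) id)))
        (twistedSum (fun x => |x| ^ p) id) (twistedNorm (fun x => |x| ^ p) id)) := by
  refine ⟨fun φ θ hφ hT ⟨K, hθ⟩ => ?_, fun p hp => ?_⟩
  · obtain ⟨ψ, hψ, he, hP, h2⟩ := hφ.exists_regular hT
    exact ⟨hφ.isCompletionOf_twistedSum hψ he hP h2 hθ,
      ⟨_, hφ.isFenchelOrliczVia hψ he hP h2 hθ⟩, ⟨ψ, hψ, he, hP, h2⟩,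
      fun χ hχ he hP h2 => ⟨hχ.isQuasiConvex_kpFunction hP h2 hθ,
        hφ.isFenchelOrliczVia hχ he hP h2 hθ⟩⟩
  · have hφ := isOrliczFunction_abs_rpow hp
    have hP := powerBound_abs_rpow hp
    have h2 := deltaTwo_abs_rpow p
    exact ⟨hφ.isCompletionOf_twistedSum hφ (fun _ _ => rfl) hP h2 LipschitzWith.id,
      hφ.isFenchelOrliczVia hφ (fun _ _ => rfl) hP h2 LipschitzWith.id⟩
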